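/- Let $\Sigma$ be a compact oriented smooth $3$-manifold without boundary and let $\mathcal V_\Sigma\to\Sigma$ be a smooth real vector bundle of rank $4$ with an $SO(3,1)$-structure, i.e. a smooth fibre metric $\eta$ of signature $(3,1)$ and a fibre orientation; use the resulting volume element to trivialize $\bigwedge^4\mathcal V_\Sigma$, so that elements of $\Omega^{3,4}_\partial$ can be integrated over $\Sigma$. Here $\Omega^{i,j}_\partial=\Omega^i(\Sigma,\bigwedge^j\mathcal V_\Sigma)$ denotes the space of smooth $i$-forms with values in $\bigwedge^j\mathcal V_\Sigma$, with its $C^\infty$ topology and with the wedge product for which $\alpha\beta=(-1)^{(i+j)(k+l)}\beta\alpha$ for $\alpha\in\Omega^{i,j}_\partial$, $\beta\in\Omega^{k,l}_\partial$. Let $e_0\in\Omega^{1,1}_\partial$ be a boundary coframe, i.e. an injective bundle map $e_0\colon T\Sigma\to\mathcal V_\Sigma$. Let $\widetilde{\mathcal F}_{LPC}=\Omega^{1,1}_\partial\times\bigl(\Omega^{1,2}_\partial/\operatorname{Ker}(e_0\wedge\cdot)\bigr)$, with elements $(b,[a])$, and let $T^*\Omega^{1,1}_\partial=\Omega^{1,1}_\partial\times\Omega^{2,3}_\partial$,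 with elements $(b,\Theta)$, where $\Theta$ is regarded as the covector $b\mapsto\int_\Sigma b\,\Theta$, with canonical form $$\varpi^\partial\bigl((b,\Theta),(b',\Theta')\bigr)=\int_\Sigma b\,\Theta'-\int_\Sigma b'\,\Theta .$$ Then $\varpi^\partial$ is a (weak) symplectic form, i.e. a continuous, bilinear, alternating and weakly non-degenerate form; the formula $$\widetilde\varpi\bigl((b,[a]),(b',[a'])\bigr)=\int_\Sigma e_0\,b\,a'-\int_\Sigma e_0\,b'\,a$$ gives a well-defined (weak) symplectic form on $\widetilde{\mathcal F}_{LPC}$; and $$\Phi\colon\widetilde{\mathcal F}_{LPC}\to T^*\Omega^{1,1}_\partial,\qquad \Phi(b,[a])=(b,\,e_0\wedge a),$$ is an isomorphism of topological vector spaces (in particular a diffeomorphism) with $\Phi^*\varpi^\partial=\widetilde\varpi$, i.e. a symplectomorphism. -/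

import Mathlib

open scoped Manifold ContDiff Topology TensorProduct
open Bundle MeasureTheory

noncomputable section

namespace LPC

/-- The model space of the three-dimensional boundary manifold. -/
abbrev E3 : Type := EuclideanSpace ℝ (Fin 3)

/-- The model fibre of the rank four bundle. -/
abbrev F4 : Type := EuclideanSpace ℝ (Fin 4)

/-! ### Wedge product on the fibres -/

section Fibre

variable {T W : Type*} [AddCommGroup T] [Module ℝ T] [AddCommGroup W] [Module ℝ W]

/-- The product `⋀^j W × ⋀^l W → ⋀^(j+l) W` of the exterior algebra. -/
def extMul (j l : ℕ) : ⋀[ℝ]^j W →ₗ[ℝ] ⋀[ℝ]^l W →ₗ[ℝ] ⋀[ℝ]^(j + l) W :=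
  LinearMap.mk₂ ℝ
    (fun u w => ⟨(u : ExteriorAlgebra ℝ W) * (w : ExteriorAlgebra ℝ W),
      SetLike.mul_mem_graded u.2 w.2⟩)
    (fun _ _ _ => Subtype.ext (add_mul _ _ _))
    (fun _ _ _ => Subtype.ext (smul_mul_assoc _ _ _))
    (fun _ _ _ => Subtype.ext (mul_add _ _ _))
    (fun _ _ _ => Subtype.ext (mul_smul_comm _ _ _))

/-- The wedge product of alternating maps with values in exterior powers: the wedge product of
forms (sum over shuffles, without further combinatorial factor) together with the product of the
exterior algebra.  The sign `(-1)^(j*k)` is the Koszul sign for moving the internal degree `j` of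
the first factor past the form degree `k` of the second one, so that elements of bidegree `(i,j)`
and `(k,l)` commute up to `(-1)^((i+j)*(k+l))` (total degree convention). -/
def fibreWedge {i j k l : ℕ} (α : T [⋀^Fin i]→ₗ[ℝ] ⋀[ℝ]^j W) (β : T [⋀^Fin k]→ₗ[ℝ] ⋀[ℝ]^l W) :
    T [⋀^Fin (i + k)]→ₗ[ℝ] ⋀[ℝ]^(j + l) W :=
  ((-1 : ℝ) ^ (j * k)) •
    ((TensorProduct.lift (extMul j l)).compAlternatingMap
      (α.domCoprod β)).domDomCongr finSumFinEquiv

theorem fibreWedge_apply {i j k l : ℕ} (α : T [⋀^Fin i]→ₗ[ℝ] ⋀[ℝ]^j W)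
    (β : T [⋀^Fin k]→ₗ[ℝ] ⋀[ℝ]^l W) (v : Fin (i + k) → T) :
    fibreWedge α β v = ((-1 : ℝ) ^ (j * k)) •
      ∑ q : Equiv.Perm.ModSumCongr (Fin i) (Fin k), ((Equiv.Perm.sign q.out : ℤ) : ℝ) •
        extMul j l (α fun n => v (finSumFinEquiv (q.out (Sum.inl n))))
          (β fun n => v (finSumFinEquiv (q.out (Sum.inr n)))) := by
  have h : ∀ (q : Equiv.Perm.ModSumCongr (Fin i) (Fin k)) (w : Fin i ⊕ Fin k → T),
      AlternatingMap.domCoprod.summand α β q w = ((Equiv.Perm.sign q.out : ℤ) : ℝ) •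
        ((α fun n => w (q.out (Sum.inl n))) ⊗ₜ[ℝ] (β fun n => w (q.out (Sum.inr n)))) := by
    intro q w
    have h1 : AlternatingMap.domCoprod.summand α β q =
        AlternatingMap.domCoprod.summand α β (Quotient.mk'' q.out) := by
      rw [Quotient.out_eq']
    rw [h1, AlternatingMap.domCoprod.summand_mk'']
    exact (Int.cast_smul_eq_zsmul ℝ (Equiv.Perm.sign q.out : ℤ)
      ((α fun n => w (q.out (Sum.inl n))) ⊗ₜ[ℝ] (β fun n => w (q.out (Sum.inr n))))).symm
  change ((-1 : ℝ) ^ (j * k)) • TensorProduct.lift (extMul j l)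
    ((α.domCoprod β) fun n => v (finSumFinEquiv n)) = _
  rw [AlternatingMap.domCoprod_apply, _root_.sum_apply, map_sum]
  congr 1
  refine Finset.sum_congr rfl fun q _ => ?_
  rw [h, map_smul, TensorProduct.lift.tmul]

theorem coe_map {W' : Type*} [AddCommGroup W'] [Module ℝ W'] (f : W →ₗ[ℝ] W') {j : ℕ}
    (u : ⋀[ℝ]^j W) :
    (exteriorPower.map j f u : ExteriorAlgebra ℝ W') = ExteriorAlgebra.map f u := by
  have h : (Submodule.subtype _).comp (exteriorPower.map j f) =
      (ExteriorAlgebra.map f).toLinearMap.comp (Submodule.subtype (⋀[ℝ]^j W)) := by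
    apply exteriorPower.linearMap_ext
    ext m
    simp [ExteriorAlgebra.map_apply_ιMulti]
  exact LinearMap.congr_fun h u

theorem fibreWedge_add {i j k l : ℕ} (α : T [⋀^Fin i]→ₗ[ℝ] ⋀[ℝ]^j W)
    (β γ : T [⋀^Fin k]→ₗ[ℝ] ⋀[ℝ]^l W) :
    fibreWedge α (β + γ) = fibreWedge α β + fibreWedge α γ := by
  ext1 v
  rw [AlternatingMap.add_apply]
  simp only [fibreWedge_apply, AlternatingMap.add_apply, map_add, smul_add, Finset.sum_add_distrib]

theorem fibreWedge_smul {i j k l : ℕ} (c : ℝ) (α : T [⋀^Fin i]→ₗ[ℝ] ⋀[ℝ]^j W)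
    (β : T [⋀^Fin k]→ₗ[ℝ] ⋀[ℝ]^l W) :
    fibreWedge α (c • β) = c • fibreWedge α β := by
  ext1 v
  rw [AlternatingMap.smul_apply]
  simp only [fibreWedge_apply, AlternatingMap.smul_apply, map_smul, Finset.smul_sum]
  refine Finset.sum_congr rfl fun q _ => ?_
  rw [smul_comm _ c, smul_comm _ c]

theorem extMul_map {W' : Type*} [AddCommGroup W'] [Module ℝ W'] (f : W →ₗ[ℝ] W') {j l : ℕ}
    (u : ⋀[ℝ]^j W) (w : ⋀[ℝ]^l W) :
    exteriorPower.map (j + l) f (extMul j l u w) =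
      extMul j l (exteriorPower.map j f u) (exteriorPower.map l f w) := by
  apply Subtype.ext
  rw [coe_map]
  change ExteriorAlgebra.map f ((u : ExteriorAlgebra ℝ W) * (w : ExteriorAlgebra ℝ W)) =
    (exteriorPower.map j f u : ExteriorAlgebra ℝ W') * (exteriorPower.map l f w)
  rw [map_mul, coe_map, coe_map]

end Fibre

/-! ### Bundle-valued forms on the boundary -/

section Forms

variable {S : Type*} [TopologicalSpace S] [ChartedSpace E3 S] [IsManifold (𝓡 3) ∞ S]
  (V : S → Type*) [TopologicalSpace (TotalSpace F4 V)] [∀ x, AddCommGroup (V x)]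
  [∀ x, Module ℝ (V x)] [∀ x, TopologicalSpace (V x)] [FiberBundle F4 V] [VectorBundle ℝ F4 V]

/-- The open set around `x₀` on which both the chart of `S` at `x₀` and the trivialization of `V`
at `x₀` are defined. -/
def nbhd (x₀ : S) : Set S := (chartAt E3 x₀).source ∩ (trivializationAt F4 V x₀).baseSet

/-- The vector of `T_x S` with coordinates `v` in the chart at `x₀` (the value at `x` of the
coordinate vector field with constant components `v`). -/
def coordVec (x₀ x : S) (v : E3) : TangentSpace (𝓡 3) x :=
  (trivializationAt E3 (TangentSpace (𝓡 3) : S → Type _) x₀).symmₗ ℝ x v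

/-- A family of elements of `Λ^i T_x^*S ⊗ ⋀^j V_x`, without any regularity in `x`. -/
abbrev RoughForm (i j : ℕ) : Type _ :=
  ∀ x : S, (TangentSpace (𝓡 3) x) [⋀^Fin i]→ₗ[ℝ] ⋀[ℝ]^j (V x)

variable {V}

/-- The local component functions of a form near `x₀`: evaluate on coordinate vector fields, read
the value in the trivialization of `V` at `x₀`, and take the component along `l`. -/
def component {i j : ℕ} (α : RoughForm V i j) (x₀ : S) (v : Fin i → E3)
    (l : Module.Dual ℝ (⋀[ℝ]^j F4)) (x : S) : ℝ :=
  l (exteriorPower.map j ((trivializationAt F4 V x₀).linearMapAt ℝ x)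
    (α x fun n => coordVec x₀ x (v n)))

variable (V)

/-- `Ω^{i,j}_∂ = Ω^i(S, ⋀^j V)`: smooth `i`-forms on `S` with values in `⋀^j V`.  Smoothness means
that all local components are smooth. -/
@[ext]
structure Form (i j : ℕ) where
  /-- The value of the form at each point. -/
  val : RoughForm V i j
  smooth : ∀ x₀ v l, ContMDiffOn (𝓡 3) 𝓘(ℝ) ∞ (component val x₀ v l) (nbhd V x₀)

variable {V}

theorem component_add {i j : ℕ} (α β : RoughForm V i j) (x₀ : S) (v : Fin i → E3)
    (l : Module.Dual ℝ (⋀[ℝ]^j F4)) :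
    component (α + β) x₀ v l = component α x₀ v l + component β x₀ v l := by
  funext x; simp [component]

theorem component_smul {i j : ℕ} (c : ℝ) (α : RoughForm V i j) (x₀ : S) (v : Fin i → E3)
    (l : Module.Dual ℝ (⋀[ℝ]^j F4)) :
    component (c • α) x₀ v l = fun x => c * component α x₀ v l x := by
  funext x; simp [component]

/-! The vector space structure on `Ω^{i,j}_∂` is the pointwise one. -/

instance {i j : ℕ} : Zero (Form V i j) :=
  ⟨⟨0, fun x₀ v l => by
    have h : component (0 : RoughForm V i j) x₀ v l = fun _ => 0 := by
      funext x; simp [component]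
    rw [h]; exact contMDiffOn_const⟩⟩

instance {i j : ℕ} : Add (Form V i j) :=
  ⟨fun α β => ⟨α.val + β.val, fun x₀ v l => by
    rw [component_add]; exact (α.smooth x₀ v l).add (β.smooth x₀ v l)⟩⟩

instance {i j : ℕ} : Neg (Form V i j) :=
  ⟨fun α => ⟨-α.val, fun x₀ v l => by
    have h : component (-α.val) x₀ v l = fun x => -component α.val x₀ v l x := by
      funext x; simp [component]
    rw [h]; exact (α.smooth x₀ v l).neg⟩⟩

instance {i j : ℕ} : SMul ℝ (Form V i j) :=
  ⟨fun c α => ⟨c • α.val, fun x₀ v l => by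
    rw [component_smul]; exact contMDiffOn_const.mul (α.smooth x₀ v l)⟩⟩

theorem val_zero {i j : ℕ} : (0 : Form V i j).val = 0 := rfl

theorem val_add {i j : ℕ} (α β : Form V i j) : (α + β).val = α.val + β.val := rfl

theorem val_neg {i j : ℕ} (α : Form V i j) : (-α).val = -α.val := rfl

theorem val_smul {i j : ℕ} (c : ℝ) (α : Form V i j) : (c • α).val = c • α.val := rfl

instance {i j : ℕ} : AddCommGroup (Form V i j) where
  add_assoc α β γ := Form.ext (add_assoc α.val β.val γ.val)
  zero_add α := Form.ext (zero_add α.val)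
  add_zero α := Form.ext (add_zero α.val)
  add_comm α β := Form.ext (add_comm α.val β.val)
  neg_add_cancel α := Form.ext (neg_add_cancel α.val)
  nsmul := nsmulRec
  zsmul := zsmulRec

instance {i j : ℕ} : Module ℝ (Form V i j) where
  one_smul α := Form.ext (one_smul ℝ α.val)
  mul_smul c d α := Form.ext (mul_smul c d α.val)
  smul_zero c := Form.ext (smul_zero c)
  smul_add c α β := Form.ext (smul_add c α.val β.val)
  add_smul c d α := Form.ext (add_smul c d α.val)
  zero_smul α := Form.ext (zero_smul ℝ α.val)

/-- The `C^∞` topology on `Ω^{i,j}_∂`: uniform convergence on compact subsets of coordinate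
neighbourhoods of all partial derivatives of all local components. -/
instance {i j : ℕ} : TopologicalSpace (Form V i j) :=
  ⨅ (x₀ : S) (v : Fin i → E3) (l : Module.Dual ℝ (⋀[ℝ]^j F4)) (k : ℕ),
    TopologicalSpace.induced
      (fun α : Form V i j =>
        UniformOnFun.ofFun {K : Set E3 | IsCompact K ∧ K ⊆ chartAt E3 x₀ '' nbhd V x₀}
          (iteratedFDeriv ℝ k (component α.val x₀ v l ∘ (chartAt E3 x₀).symm)))
      inferInstance

theorem component_wedge {i j k l : ℕ} (α : RoughForm V i j) (β : RoughForm V k l) (x₀ : S)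
    (v : Fin (i + k) → E3) (m : Module.Dual ℝ (⋀[ℝ]^(j + l) F4)) :
    component (fun x => fibreWedge (α x) (β x)) x₀ v m = fun x =>
      ((-1 : ℝ) ^ (j * k)) *
      ∑ q : Equiv.Perm.ModSumCongr (Fin i) (Fin k), ((Equiv.Perm.sign q.out : ℤ) : ℝ) *
        ∑ a, ∑ b,
          component α x₀ (fun n => v (finSumFinEquiv (q.out (Sum.inl n))))
            ((Module.finBasis ℝ (⋀[ℝ]^j F4)).coord a) x *
          component β x₀ (fun n => v (finSumFinEquiv (q.out (Sum.inr n))))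
            ((Module.finBasis ℝ (⋀[ℝ]^l F4)).coord b) x *
          m (extMul j l (Module.finBasis ℝ (⋀[ℝ]^j F4) a) (Module.finBasis ℝ (⋀[ℝ]^l F4) b)) := by
  funext x
  have key : ∀ (u : ⋀[ℝ]^j F4) (w : ⋀[ℝ]^l F4), m (extMul j l u w) =
      ∑ a, ∑ b, (Module.finBasis ℝ (⋀[ℝ]^j F4)).coord a u *
        (Module.finBasis ℝ (⋀[ℝ]^l F4)).coord b w *
        m (extMul j l (Module.finBasis ℝ (⋀[ℝ]^j F4) a) (Module.finBasis ℝ (⋀[ℝ]^l F4) b)) := by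
    intro u w
    conv_lhs => rw [← (Module.finBasis ℝ (⋀[ℝ]^j F4)).sum_repr u,
      ← (Module.finBasis ℝ (⋀[ℝ]^l F4)).sum_repr w]
    simp only [map_sum, map_smul, LinearMap.sum_apply, LinearMap.smul_apply, smul_eq_mul,
      Module.Basis.coord_apply, Finset.mul_sum]
    rw [Finset.sum_comm]
    refine Finset.sum_congr rfl fun a _ => Finset.sum_congr rfl fun b _ => ?_
    ring
  simp only [component, fibreWedge_apply, map_smul, map_sum, smul_eq_mul, extMul_map]
  congr 1
  refine Finset.sum_congr rfl fun q _ => ?_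
  rw [key]

/-- The wedge product `Ω^{i,j}_∂ × Ω^{k,l}_∂ → Ω^{i+k,j+l}_∂`. -/
def wedge {i j k l : ℕ} (α : Form V i j) (β : Form V k l) : Form V (i + k) (j + l) where
  val x := fibreWedge (α.val x) (β.val x)
  smooth x₀ v m := by
    rw [component_wedge]
    refine contMDiffOn_const.mul (contMDiffOn_finsetSum fun q _ => contMDiffOn_const.mul
      (contMDiffOn_finsetSum fun a _ => contMDiffOn_finsetSum fun b _ => ?_))
    exact ((α.smooth _ _ _).mul (β.smooth _ _ _)).mul contMDiffOn_const

/-- The linear map `e₀ ∧ · : Ω^{i,j}_∂ → Ω^{i+1,j+1}_∂`. -/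
def wedgeLeft (e₀ : Form V 1 1) (i j : ℕ) : Form V i j →ₗ[ℝ] Form V (1 + i) (1 + j) where
  toFun := wedge e₀
  map_add' α β := Form.ext (funext fun x => fibreWedge_add (e₀.val x) (α.val x) (β.val x))
  map_smul' c α := Form.ext (funext fun x => fibreWedge_smul c (e₀.val x) (α.val x))

/-- A `V`-valued one-form `e₀` is a boundary coframe if it is an injective bundle map `TS → V`
(here `⋀^1 V = V`). -/
def IsBoundaryCoframe (e₀ : Form V 1 1) : Prop :=
  ∀ x : S, Function.Injective fun v : TangentSpace (𝓡 3) x => e₀.val x fun _ => v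

variable (V)

/-- A smooth `SO(3,1)`-structure on `V`: a smooth fibre metric `metric` and a smooth fibrewise volume
form `vol` such that each fibre has a basis which is orthonormal of signature `(3,1)` and on which
`vol` is one.  Thus `vol` is the volume form of a Lorentzian metric and an orientation of `V`. -/
structure LorentzStructure where
  /-- The fibre metric. -/
  metric : ∀ x : S, V x →ₗ[ℝ] V x →ₗ[ℝ] ℝ
  /-- The fibrewise volume form. -/
  vol : ∀ x : S, V x [⋀^Fin 4]→ₗ[ℝ] ℝ
  metric_smooth : ∀ (x₀ : S) (u w : F4), ContMDiffOn (𝓡 3) 𝓘(ℝ) ∞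
    (fun x => metric x ((trivializationAt F4 V x₀).symmₗ ℝ x u)
      ((trivializationAt F4 V x₀).symmₗ ℝ x w)) (trivializationAt F4 V x₀).baseSet
  vol_smooth : ∀ (x₀ : S) (u : Fin 4 → F4), ContMDiffOn (𝓡 3) 𝓘(ℝ) ∞
    (fun x => vol x fun n => (trivializationAt F4 V x₀).symmₗ ℝ x (u n))
    (trivializationAt F4 V x₀).baseSet
  exists_frame : ∀ x : S, ∃ f : Module.Basis (Fin 4) ℝ (V x),
    (∀ a b, metric x (f a) (f b) = if a = b then (if a = 3 then -1 else 1) else 0) ∧ vol x f = 1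

end Forms

/-! ### Orientation and integration -/

section Integration

variable {S : Type*} [TopologicalSpace S] [ChartedSpace E3 S] [IsManifold (𝓡 3) ∞ S]

/-- The coordinate vector fields `∂_1, ∂_2, ∂_3` of the chart at `x₀`, at the point `x`. -/
def coordFrame (x₀ x : S) (n : Fin 3) : TangentSpace (𝓡 3) x :=
  coordVec x₀ x (EuclideanSpace.basisFun (Fin 3) ℝ n)

open Classical in
/-- The sign (`1` or `-1`) of the coordinate frame of the chart at `x₀` with respect to given
orientations of the tangent spaces, at a point `x` of the chart domain. -/
def coordSign (o : ∀ x : S, Orientation ℝ (TangentSpace (𝓡 3) x) (Fin 3)) (x₀ x : S) : ℝ :=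
  if ∃ f : Module.Basis (Fin 3) ℝ (TangentSpace (𝓡 3) x),
    (∀ n, f n = coordFrame x₀ x n) ∧ f.orientation = o x then 1 else -1

variable (S) in
/-- An orientation of the three-manifold `S`: orientations of the tangent spaces, locally constant in
charts. -/
structure ManifoldOrientation where
  /-- The orientation of each tangent space. -/
  orient : ∀ x : S, Orientation ℝ (TangentSpace (𝓡 3) x) (Fin 3)
  locallyConstant : ∀ x₀ : S, ContinuousOn (coordSign orient x₀) (chartAt E3 x₀).source

variable (S) in
/-- A smooth partition of unity on `S` subordinate to the chart domains. -/
def chartPartition [T2Space S] [SigmaCompactSpace S] : SmoothPartitionOfUnity S (𝓡 3) S Set.univ :=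
  (SmoothPartitionOfUnity.exists_isSubordinate_chartAt_source (𝓡 3) S).choose

theorem chartPartition_isSubordinate [T2Space S] [SigmaCompactSpace S] :
    (chartPartition S).IsSubordinate fun x => (chartAt E3 x).source :=
  (SmoothPartitionOfUnity.exists_isSubordinate_chartAt_source (𝓡 3) S).choose_spec

variable {V : S → Type*} [TopologicalSpace (TotalSpace F4 V)] [∀ x, AddCommGroup (V x)]
  [∀ x, Module ℝ (V x)] [∀ x, TopologicalSpace (V x)] [FiberBundle F4 V] [VectorBundle ℝ F4 V]

/-- The coefficient of `dx¹dx²dx³` of the density defined by an element of `Ω^{3,4}_∂`, in the chart at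
`x₀`: `⋀^4 V` is trivialized by the volume form, and the sign compares the chart with the
orientation. -/
def density (o : ManifoldOrientation S) (L : LorentzStructure V) (η : Form V 3 4) (x₀ x : S) : ℝ :=
  coordSign o.orient x₀ x *
    exteriorPower.alternatingMapLinearEquiv (L.vol x) (η.val x (coordFrame x₀ x))

/-- The integral over `S` of an element of `Ω^{3,4}_∂`, by a partition of unity subordinate to
charts. -/
def formIntegral [T2Space S] [SigmaCompactSpace S] (o : ManifoldOrientation S) (L : LorentzStructure V)
    (η : Form V 3 4) : ℝ :=
  ∑ᶠ x₀ : S, ∫ y in (chartAt E3 x₀).target,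
    chartPartition S x₀ ((chartAt E3 x₀).symm y) * density o L η x₀ ((chartAt E3 x₀).symm y)

end Integration

/-! ### Phase spaces -/

/-- A symplectic form on a topological vector space: a continuous bilinear alternating form which is
(weakly) non-degenerate.  As a two-form with constant coefficients it is closed. -/
structure IsSymplecticForm {E : Type*} [AddCommGroup E] [Module ℝ E] [TopologicalSpace E]
    (σ : E → E → ℝ) : Prop where
  bilinear : ∃ B : E →ₗ[ℝ] E →ₗ[ℝ] ℝ, ∀ p q, σ p q = B p q
  continuous : Continuous fun p : E × E => σ p.1 p.2
  alternating : ∀ p, σ p p = 0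
  nondegenerate : ∀ p, (∀ q, σ p q = 0) → p = 0

section PhaseSpace

variable {S : Type*} [TopologicalSpace S] [ChartedSpace E3 S] [IsManifold (𝓡 3) ∞ S]
  (V : S → Type*) [TopologicalSpace (TotalSpace F4 V)] [∀ x, AddCommGroup (V x)]
  [∀ x, Module ℝ (V x)] [∀ x, TopologicalSpace (V x)] [FiberBundle F4 V] [VectorBundle ℝ F4 V]

/-- The cotangent bundle `T^*Ω^{1,1}_∂ = Ω^{1,1}_∂ × Ω^{2,3}_∂`, with base coordinate `b` and fibre
coordinate `Θ`; the covector `Θ` is the functional `b ↦ ∫ b ∧ Θ`. -/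
abbrev CotangentSpace : Type _ := Form V 1 1 × Form V 2 3

variable {V}

/-- The geometric phase space of the linearized theory: pairs `(b, [a])`, with `b ∈ Ω^{1,1}_∂` and
`[a]` the class of `a ∈ Ω^{1,2}_∂` modulo the kernel of `e₀ ∧ ·`. -/
abbrev PhaseSpace (e₀ : Form V 1 1) : Type _ :=
  Form V 1 1 × (Form V 1 2 ⧸ LinearMap.ker (wedgeLeft e₀ 1 2))

variable [T2Space S] [SigmaCompactSpace S]

/-- The tautological one-form of `T^*Ω^{1,1}_∂`: at `p = (b, Θ)`, on the tangent vector
`q = (b', Θ')`, it is `Θ(b') = ∫ b' ∧ Θ`. -/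
def tautologicalForm (o : ManifoldOrientation S) (L : LorentzStructure V)
    (p q : CotangentSpace V) : ℝ :=
  formIntegral o L (wedge q.1 p.2)

/-- The canonical symplectic form `∫ δb δΘ` of `T^*Ω^{1,1}_∂`, which is minus the differential of the
tautological one-form. -/
def canonicalForm (o : ManifoldOrientation S) (L : LorentzStructure V)
    (p q : CotangentSpace V) : ℝ :=
  tautologicalForm o L q p - tautologicalForm o L p q

/-- The two-form `∫ e₀ δb δa` on the space of pairs `(b, a)`. -/
def preForm (o : ManifoldOrientation S) (L : LorentzStructure V) (e₀ : Form V 1 1)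
    (p q : Form V 1 1 × Form V 1 2) : ℝ :=
  formIntegral o L (wedge (wedge e₀ p.1) q.2) - formIntegral o L (wedge (wedge e₀ q.1) p.2)

end PhaseSpace

end LPC

end

/-!
Since `b ∧ (e₀ ∧ a) = (e₀ ∧ b) ∧ a`, everything on the phase space is the pullback of its
counterpart on the cotangent space along `(b, [a]) ↦ (b, e₀ ∧ a)`, and two facts remain. First, the
pairing `∫ b ∧ Θ` is weakly nondegenerate, because the wedge pairing is perfect on each fibre and a
form which does not vanish at a point has nonzero integral after multiplication with a bump
function. Second, `e₀ ∧ ·` from `Ω^{1,2}` to `Ω^{2,3}` has a continuous linear right inverse. On the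
fibres, two traces show that `e₀ ∧ b = 0` forces `b = 0` for `b` of bidegree `(1, 1)`, as
`dim T_x S = 3`, and duality turns this into surjectivity on bidegree `(1, 2)`. A right inverse of
a fibrewise surjective operator on a compact base comes from finitely many forms which span every
fibre: their images span the target fibres, and the coefficients of least norm of `Θ` in these
images are smooth by Cramer's rule.
-/

noncomputable section

namespace LPC

section ExteriorAlgebra

open CliffordAlgebra (contractLeft)

section CommRing

variable {R M : Type*} [CommRing R] [AddCommGroup M] [Module R M]

theorem ι_mul_ι_comm (u v : M) :
    ExteriorAlgebra.ι R u * ExteriorAlgebra.ι R v =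
      -(ExteriorAlgebra.ι R v * ExteriorAlgebra.ι R u) :=
  eq_neg_of_add_eq_zero_left (ExteriorAlgebra.ι_add_mul_swap u v)

theorem ι_mem_exteriorPower_one (w : M) : ExteriorAlgebra.ι R w ∈ ⋀[R]^1 M :=
  (pow_one (LinearMap.range (ExteriorAlgebra.ι R : M →ₗ[R] _))).ge (LinearMap.mem_range_self _ w)

theorem contractLeft_ι_mul_ι (d : Module.Dual R M) (u v : M) :
    contractLeft d (ExteriorAlgebra.ι R u * ExteriorAlgebra.ι R v) =
      ExteriorAlgebra.ι R (d u • v - d v • u) := by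
  rw [CliffordAlgebra.contractLeft_ι_mul, CliffordAlgebra.contractLeft_ι, map_sub, map_smul,
    map_smul, ← Algebra.commutes, ← Algebra.smul_def]

theorem sum_ι_mul_contractLeft_coord {κ : Type*} [Fintype κ] (f : Module.Basis κ R M) {j : ℕ}
    {x : ExteriorAlgebra R M} (hx : x ∈ ⋀[R]^j M) :
    ∑ a, ExteriorAlgebra.ι R (f a) * contractLeft (f.coord a) x = j • x := by
  induction hx using Submodule.pow_induction_on_left' with
  | algebraMap r => simp only [CliffordAlgebra.contractLeft_algebraMap, mul_zero,
      Finset.sum_const_zero, zero_smul]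
  | add _ _ _ _ _ ihx ihy =>
    simp only [map_add, mul_add, Finset.sum_add_distrib, ihx, ihy, smul_add]
  | mem_mul m hm i x _ ih =>
    obtain ⟨w, rfl⟩ := hm
    have hw : ∑ a, f.coord a w • ExteriorAlgebra.ι R (f a) = ExteriorAlgebra.ι R w := by
      simp only [← map_smul, ← map_sum, Module.Basis.coord_apply, f.sum_repr]
    calc ∑ a, ExteriorAlgebra.ι R (f a) * contractLeft (f.coord a) (ExteriorAlgebra.ι R w * x)
        = (∑ a, f.coord a w • ExteriorAlgebra.ι R (f a)) * x +
            ExteriorAlgebra.ι R w *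
              ∑ a, ExteriorAlgebra.ι R (f a) * contractLeft (f.coord a) x := by
          rw [Finset.sum_mul, Finset.mul_sum, ← Finset.sum_add_distrib]
          refine Finset.sum_congr rfl fun a _ => ?_
          rw [CliffordAlgebra.contractLeft_ι_mul, mul_sub, ← mul_assoc, ← mul_assoc,
            ι_mul_ι_comm (f a) w, mul_smul_comm, smul_mul_assoc]
          noncomm_ring
      _ = (i + 1) • (ExteriorAlgebra.ι R w * x) := by
          rw [hw, ih, mul_smul_comm, succ_nsmul']

theorem reverse_mem_exteriorPower {j : ℕ} {x : ExteriorAlgebra R M} (hx : x ∈ ⋀[R]^j M) :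
    CliffordAlgebra.reverse x ∈ ⋀[R]^j M := by
  have h := CliffordAlgebra.submodule_map_pow_reverse (Q := (0 : QuadraticForm R M))
    (LinearMap.range (ExteriorAlgebra.ι R)) j
  rw [CliffordAlgebra.ι_range_map_reverse] at h
  exact h.le (Submodule.mem_map_of_mem hx)

end CommRing

section Field

variable {K M : Type*} [Field K] [CharZero K] [AddCommGroup M] [Module K M]
  [FiniteDimensional K M]

theorem exists_ι_mul_ne_zero {j : ℕ} (hj : j < Module.finrank K M) {x : ExteriorAlgebra K M}
    (hx : x ∈ ⋀[K]^j M) (hx0 : x ≠ 0) : ∃ w : M, ExteriorAlgebra.ι K w * x ≠ 0 := by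
  by_contra! h
  let f := Module.finBasis K M
  have hsum : ∑ a, contractLeft (f.coord a) (ExteriorAlgebra.ι K (f a) * x) =
      Module.finrank K M • x - j • x := by
    simp only [CliffordAlgebra.contractLeft_ι_mul, Finset.sum_sub_distrib,
      sum_ι_mul_contractLeft_coord f hx]
    simp [Module.Basis.coord_apply]
  have h0 : ((Module.finrank K M - j : ℕ) : K) • x = 0 := by
    rw [Nat.cast_smul_eq_nsmul, sub_nsmul _ hj.le, ← sub_eq_add_neg, ← hsum]
    simp only [h, map_zero, Finset.sum_const_zero]
  exact (smul_ne_zero (Nat.cast_ne_zero.2 (Nat.sub_ne_zero_of_lt hj)) hx0) h0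

theorem exists_mul_left_ne_zero {j l : ℕ} (hjl : j + l ≤ Module.finrank K M)
    {x : ExteriorAlgebra K M} (hx : x ∈ ⋀[K]^j M) (hx0 : x ≠ 0) :
    ∃ y ∈ ⋀[K]^l M, y * x ≠ 0 := by
  induction l with
  | zero => exact ⟨1, SetLike.GradedOne.one_mem (A := fun n : ℕ => ⋀[K]^n M), by rwa [one_mul]⟩
  | succ l ih =>
    obtain ⟨y, hy, hyx⟩ := ih (by lia)
    have hyx_mem : y * x ∈ ⋀[K]^(l + j) M := SetLike.mul_mem_graded hy hx
    obtain ⟨w, hw⟩ := exists_ι_mul_ne_zero (by lia) hyx_mem hyx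
    refine ⟨ExteriorAlgebra.ι K w * y, ?_, by rwa [mul_assoc]⟩
    rw [add_comm l 1]
    exact SetLike.mul_mem_graded (ι_mem_exteriorPower_one w) hy

theorem exists_mul_right_ne_zero {j l : ℕ} (hjl : j + l ≤ Module.finrank K M)
    {x : ExteriorAlgebra K M} (hx : x ∈ ⋀[K]^j M) (hx0 : x ≠ 0) :
    ∃ y ∈ ⋀[K]^l M, x * y ≠ 0 := by
  obtain ⟨y, hy, hyx⟩ := exists_mul_left_ne_zero hjl (reverse_mem_exteriorPower hx)
    (fun h => hx0 (CliffordAlgebra.reverse_involutive.injective (h.trans (map_zero _).symm)))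
  refine ⟨CliffordAlgebra.reverse y, reverse_mem_exteriorPower hy, fun h => hyx ?_⟩
  have h' := congrArg CliffordAlgebra.reverse h
  rwa [CliffordAlgebra.reverse.map_mul, CliffordAlgebra.reverse_reverse, map_zero] at h'

end Field
end ExteriorAlgebra

section Contraction

theorem sum_coord_apply_basis_eq_trace {R M κ : Type*} [CommRing R] [AddCommGroup M] [Module R M]
    [Fintype κ] (t : Module.Basis κ R M) (F : M →ₗ[R] M) :
    ∑ a, t.coord a (F (t a)) = LinearMap.trace R M F := by
  classical
  rw [LinearMap.trace_eq_matrix_trace R t, Matrix.trace]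
  simp only [Matrix.diag_apply, LinearMap.toMatrix_apply, Module.Basis.coord_apply]

variable {K T W : Type*} [Field K] [AddCommGroup T] [Module K T] [FiniteDimensional K T]
  [AddCommGroup W] [Module K W] {E B : T →ₗ[K] W}

/-- The trace over `u` of the symmetry hypothesis contracted with the covectors `t^a ∘ P`. -/
theorem finrank_smul_sub_eq_of_forall_ι_mul_ι_eq {P : W →ₗ[K] T} (hPE : ∀ v, P (E v) = v)
    (h : ∀ u v, ExteriorAlgebra.ι K (E u) * ExteriorAlgebra.ι K (B v) =
      ExteriorAlgebra.ι K (E v) * ExteriorAlgebra.ι K (B u)) (v : T) :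
    (Module.finrank K T : K) • B v - E (P (B v)) =
      B v - LinearMap.trace K T (P ∘ₗ B) • E v := by
  let t := Module.finBasis K T
  have hcontract : ∀ (ξ : Module.Dual K W) (u v : T),
      ξ (E u) • B v - ξ (B v) • E u = ξ (E v) • B u - ξ (B u) • E v := fun ξ u v =>
    ExteriorAlgebra.ι_leftInverse.injective (by
      rw [← contractLeft_ι_mul_ι, ← contractLeft_ι_mul_ι, h])
  have hrepr : ∀ (F : T →ₗ[K] W) (u : T), ∑ a, t.coord a u • F (t a) = F u := fun F u => by
    simp only [← map_smul, ← map_sum, Module.Basis.coord_apply, t.sum_repr]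
  have htrace : ∑ a, t.coord a (P (B (t a))) = LinearMap.trace K T (P ∘ₗ B) :=
    sum_coord_apply_basis_eq_trace t (P ∘ₗ B)
  have hfinrank : ∑ a, t.coord a (t a) = (Module.finrank K T : K) := by
    simp [Module.Basis.coord_apply]
  have hsum := Finset.sum_congr rfl fun a (_ : a ∈ Finset.univ) =>
    hcontract (t.coord a ∘ₗ P) (t a) v
  simpa only [LinearMap.comp_apply, hPE, Finset.sum_sub_distrib, hrepr, ← Finset.sum_smul, htrace,
    hfinrank] using hsum

/-- With a left inverse `P` of `E`, the traced identity forces `(n - 2) P B = -tr (P B)`; its own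
trace is `(2 n - 2) tr (P B) = 0`. -/
theorem eq_zero_of_forall_ι_mul_ι_eq [CharZero K] (hT : 3 ≤ Module.finrank K T)
    (hE : Function.Injective E)
    (h : ∀ u v, ExteriorAlgebra.ι K (E u) * ExteriorAlgebra.ι K (B v) =
      ExteriorAlgebra.ι K (E v) * ExteriorAlgebra.ι K (B u)) : B = 0 := by
  obtain ⟨P, hP⟩ := E.exists_leftInverse_of_injective (LinearMap.ker_eq_bot.2 hE)
  have hPE : ∀ v, P (E v) = v := LinearMap.congr_fun hP
  have hsum := finrank_smul_sub_eq_of_forall_ι_mul_ι_eq hPE h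
  set n := Module.finrank K T
  set τ := LinearMap.trace K T (P ∘ₗ B) with hτ_def
  have hPB : ((n : K) - 2) • (P ∘ₗ B) = -τ • LinearMap.id := by
    refine LinearMap.ext fun v => ?_
    have := congrArg P (hsum v)
    simp only [map_sub, map_smul, hPE] at this
    change ((n : K) - 2) • P (B v) = -τ • v
    rw [sub_smul, two_smul, ← sub_sub, this, neg_smul]
    abel
  obtain ⟨k, hk⟩ := Nat.exists_eq_add_of_le hT
  have hn : (n : K) = (k + 2 : ℕ) + 1 := by rw [hk]; push_cast; ring
  have hτ : τ = 0 := by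
    have htrace := congrArg (LinearMap.trace K T) hPB
    rw [map_smul, map_smul, LinearMap.trace_id, ← hτ_def, smul_eq_mul, smul_eq_mul] at htrace
    have : ((2 * (k + 2) : ℕ) : K) * τ = 0 := by
      push_cast at hn ⊢
      linear_combination htrace - 2 * τ * hn
    exact (mul_eq_zero.1 this).resolve_left (Nat.cast_ne_zero.2 (by lia))
  have hPB_zero : P ∘ₗ B = 0 := by
    rw [hτ, neg_zero, zero_smul] at hPB
    refine (smul_eq_zero.1 hPB).resolve_left ?_
    rw [show (n : K) - 2 = (k + 1 : ℕ) by rw [hn]; push_cast; ring]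
    exact Nat.cast_ne_zero.2 k.succ_ne_zero
  refine LinearMap.ext fun v => ?_
  have := hsum v
  rw [← LinearMap.comp_apply P B, hPB_zero, hτ, LinearMap.zero_apply, map_zero, sub_zero, zero_smul,
    sub_zero, hn, add_smul, one_smul, add_eq_right] at this
  exact (smul_eq_zero.1 this).resolve_left (Nat.cast_ne_zero.2 (by lia))

end Contraction

section DomCoprod

variable {R M N₁ N₂ ι κ : Type*} [CommRing R] [AddCommGroup M] [Module R M] [AddCommGroup N₁]
  [Module R N₁] [AddCommGroup N₂] [Module R N₂] [Fintype ι] [Fintype κ] [DecidableEq ι]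
  [DecidableEq κ]

theorem domCoprod_apply_eq_tmul (α : M [⋀^ι]→ₗ[R] N₁) (β : M [⋀^κ]→ₗ[R] N₂) (v : ι ⊕ κ → M)
    (h : ∀ σ ∉ (Equiv.Perm.sumCongrHom ι κ).range,
      (α fun n => v (σ (Sum.inl n))) ⊗ₜ[R] (β fun n => v (σ (Sum.inr n))) = 0) :
    α.domCoprod β v = (α fun n => v (Sum.inl n)) ⊗ₜ (β fun n => v (Sum.inr n)) := by
  rw [AlternatingMap.domCoprod_apply, _root_.sum_apply]
  refine (Fintype.sum_eq_single (Quotient.mk'' 1) fun q hq => ?_).trans ?_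
  · induction q using Quotient.inductionOn' with | _ σ
    have hσ : σ ∉ (Equiv.Perm.sumCongrHom ι κ).range := fun hmem =>
      hq (Quotient.sound' (QuotientGroup.leftRel_apply.2 (by simpa using hmem)))
    rw [AlternatingMap.domCoprod.summand_mk'', _root_.smul_apply,
      MultilinearMap.domDomCongr_apply, MultilinearMap.domCoprod_apply]
    exact (congrArg _ (h σ hσ)).trans (smul_zero _)
  · rw [AlternatingMap.domCoprod.summand_mk'', Equiv.Perm.sign_one, one_smul]
    rfl

/-- The determinant of the coordinates with indices in the family `g`. -/
def coordDet {ν : Type*} (t : Module.Basis ν R M) (g : κ → ν) : M [⋀^κ]→ₗ[R] R :=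
  Matrix.detRowAlternating.compLinearMap (LinearMap.pi fun a => t.coord (g a))

variable {ν : Type*} (t : Module.Basis ν R M) {g : κ → ν}

theorem coordDet_basis (hg : Function.Injective g) : coordDet t g (fun a => t (g a)) = 1 := by
  classical
  have hone : (fun a => LinearMap.pi (fun b => t.coord (g b)) (t (g a))) =
      (1 : Matrix κ κ R) := by
    ext a b
    simp [Matrix.one_apply, Finsupp.single_apply, hg.eq_iff]
  rw [coordDet, AlternatingMap.compLinearMap_apply]
  exact (congrArg Matrix.det hone).trans Matrix.det_one

theorem coordDet_eq_zero {h : κ → ν} {a : κ} (ha : h a ∉ Set.range g) :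
    coordDet t g (fun b => t (h b)) = 0 := by
  classical
  rw [coordDet, AlternatingMap.compLinearMap_apply]
  refine AlternatingMap.map_coord_zero _ a (funext fun b => ?_)
  rw [LinearMap.pi_apply, Module.Basis.coord_apply, t.repr_self_apply]
  exact if_neg fun hab => ha ⟨b, hab.symm⟩

end DomCoprod

theorem exists_basis_sum_inl_eq {K M ι κ : Type*} [Field K] [AddCommGroup M] [Module K M]
    [FiniteDimensional K M] [Fintype ι] [Fintype κ] {u : ι → M} (hu : LinearIndependent K u)
    (hcard : Module.finrank K M = Fintype.card ι + Fintype.card κ) :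
    ∃ t : Module.Basis (ι ⊕ κ) K M, ∀ n, t (Sum.inl n) = u n := by
  let s := Module.Basis.sumExtend hu
  have : Finite (ι ⊕ Module.Basis.sumExtendIndex hu) := Module.Finite.finite_basis s
  have : Finite (Module.Basis.sumExtendIndex hu) := Finite.sum_right ι
  obtain ⟨e⟩ : Nonempty (Module.Basis.sumExtendIndex hu ≃ κ) := Finite.card_eq.1 <| by
    have hs := Module.finrank_eq_nat_card_basis s
    rw [Nat.card_sum, hcard, Nat.card_eq_fintype_card, add_right_inj] at hs
    rw [← hs, Nat.card_eq_fintype_card]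
  refine ⟨s.reindex (Equiv.sumCongr (Equiv.refl ι) e), fun n => ?_⟩
  simp only [Module.Basis.reindex_apply, Equiv.sumCongr_symm, Equiv.sumCongr_apply, Sum.map_inl,
    Equiv.refl_symm, Equiv.refl_apply, s, Module.Basis.sumExtend, Module.Basis.extend_apply_self]
  rfl

theorem alternatingMapLinearEquiv_injective {K M : Type*} [Field K] [AddCommGroup M] [Module K M]
    [FiniteDimensional K M] {n : ℕ} (hn : Module.finrank K M = n) {vol : M [⋀^Fin n]→ₗ[K] K}
    (hvol : vol ≠ 0) : Function.Injective (exteriorPower.alternatingMapLinearEquiv vol) := by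
  have hfin : Module.finrank K (⋀[K]^n M) = Module.finrank K K := by
    rw [exteriorPower.finrank_eq, hn, Nat.choose_self, Module.finrank_self]
  rw [LinearMap.injective_iff_surjective_of_finrank_eq_finrank hfin]
  exact LinearMap.surjective ((LinearEquiv.map_ne_zero_iff _).2 hvol)

section FibrePairing

variable {T W : Type*} [AddCommGroup T] [Module ℝ T] [AddCommGroup W] [Module ℝ W]

theorem fibreWedge_ne_zero_of_mul_ne_zero {i j k l : ℕ} {α : T [⋀^Fin i]→ₗ[ℝ] ⋀[ℝ]^j W}
    {β : T [⋀^Fin k]→ₗ[ℝ] ⋀[ℝ]^l W} (v : Fin i ⊕ Fin k → T)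
    (h : ∀ σ ∉ (Equiv.Perm.sumCongrHom (Fin i) (Fin k)).range,
      (α fun n => v (σ (Sum.inl n))) ⊗ₜ[ℝ] (β fun n => v (σ (Sum.inr n))) = 0)
    (hv : ((α fun n => v (Sum.inl n) : ⋀[ℝ]^j W) : ExteriorAlgebra ℝ W) *
      (β fun n => v (Sum.inr n) : ⋀[ℝ]^l W) ≠ 0) :
    fibreWedge α β ≠ 0 := by
  intro hzero
  have h0 : ((-1 : ℝ) ^ (j * k)) • TensorProduct.lift (extMul j l)
      (α.domCoprod β fun n => v (finSumFinEquiv.symm (finSumFinEquiv n))) = 0 :=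
    AlternatingMap.congr_fun hzero fun n => v (finSumFinEquiv.symm n)
  simp only [Equiv.symm_apply_apply] at h0
  rw [domCoprod_apply_eq_tmul α β v h, TensorProduct.lift.tmul] at h0
  exact hv (congrArg Subtype.val ((smul_eq_zero.1 h0).resolve_left (by simp)))

variable [FiniteDimensional ℝ T] [FiniteDimensional ℝ W] {i j k l : ℕ}

theorem exists_fibreWedge_right_ne_zero (hT : Module.finrank ℝ T = i + k)
    (hW : j + l ≤ Module.finrank ℝ W) {α : T [⋀^Fin i]→ₗ[ℝ] ⋀[ℝ]^j W} (hα : α ≠ 0) :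
    ∃ β : T [⋀^Fin k]→ₗ[ℝ] ⋀[ℝ]^l W, fibreWedge α β ≠ 0 := by
  obtain ⟨u, hu⟩ := DFunLike.ne_iff.1 hα
  obtain ⟨t, ht⟩ := exists_basis_sum_inl_eq (κ := Fin k)
    (not_imp_comm.1 (α.map_linearDependent u) hu) (by simpa using hT)
  obtain ⟨w, hw, huw⟩ := exists_mul_right_ne_zero hW (α u).2 (Subtype.coe_ne_coe.2 hu)
  refine ⟨(coordDet t Sum.inr).smulRight ⟨w, hw⟩,
    fibreWedge_ne_zero_of_mul_ne_zero t (fun σ hσ => ?_) ?_⟩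
  · obtain ⟨m, hm⟩ : ∃ m, σ (Sum.inr m) ∉ Set.range Sum.inr := by
      by_contra! h
      exact hσ (Equiv.Perm.mem_sumCongrHom_range_of_perm_mapsTo_inl
        ((Equiv.Perm.perm_mapsTo_inl_iff_mapsTo_inr σ).2 (by rintro _ ⟨m, rfl⟩; exact h m)))
    rw [AlternatingMap.smulRight_apply, coordDet_eq_zero t (h := fun n => σ (Sum.inr n)) hm,
      zero_smul, TensorProduct.tmul_zero]
  · rw [AlternatingMap.smulRight_apply, coordDet_basis t Sum.inr_injective, one_smul]
    simpa only [ht] using huw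

theorem exists_fibreWedge_left_ne_zero (hT : Module.finrank ℝ T = i + k)
    (hW : j + l ≤ Module.finrank ℝ W) {β : T [⋀^Fin k]→ₗ[ℝ] ⋀[ℝ]^l W} (hβ : β ≠ 0) :
    ∃ α : T [⋀^Fin i]→ₗ[ℝ] ⋀[ℝ]^j W, fibreWedge α β ≠ 0 := by
  obtain ⟨u, hu⟩ := DFunLike.ne_iff.1 hβ
  obtain ⟨t, ht⟩ := exists_basis_sum_inl_eq (κ := Fin i)
    (not_imp_comm.1 (β.map_linearDependent u) hu) (by simpa [add_comm] using hT)
  obtain ⟨w, hw, hwu⟩ := exists_mul_left_ne_zero (by rwa [add_comm] at hW) (β u).2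
    (Subtype.coe_ne_coe.2 hu)
  let t' := t.reindex (Equiv.sumComm _ _)
  have ht' : ∀ n, t' (Sum.inr n) = u n := fun n => by simp [t', ht]
  refine ⟨(coordDet t' Sum.inl).smulRight ⟨w, hw⟩,
    fibreWedge_ne_zero_of_mul_ne_zero t' (fun σ hσ => ?_) ?_⟩
  · obtain ⟨m, hm⟩ : ∃ m, σ (Sum.inl m) ∉ Set.range Sum.inl := by
      by_contra! h
      exact hσ (Equiv.Perm.mem_sumCongrHom_range_of_perm_mapsTo_inl
        (by rintro _ ⟨m, rfl⟩; exact h m))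
    rw [AlternatingMap.smulRight_apply, coordDet_eq_zero t' (h := fun n => σ (Sum.inl n)) hm,
      zero_smul, TensorProduct.zero_tmul]
  · rw [AlternatingMap.smulRight_apply, coordDet_basis t' Sum.inl_injective, one_smul]
    simpa only [ht'] using hwu

end FibrePairing

section AltSum

variable {ι κ T A : Type*} [Fintype ι] [DecidableEq ι] [Fintype κ] [DecidableEq κ]
  [AddCommGroup A]

/-- The signed sum of `f` over all permutations of its arguments. -/
def altSum (f : (ι → T) → A) (v : ι → T) : A :=
  ∑ σ : Equiv.Perm ι, Equiv.Perm.sign σ • f (v ∘ σ)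

theorem smul_altSum {R : Type*} [Monoid R] [DistribMulAction R A] (c : R) (f : (ι → T) → A)
    (v : ι → T) : c • altSum f v = altSum (fun u => c • f u) v := by
  simp only [altSum, Finset.smul_sum, Units.smul_def, smul_comm c]

theorem altSum_comp_equiv (e : κ ≃ ι) (f : (κ → T) → A) (v : ι → T) :
    altSum f (v ∘ e) = altSum (fun u => f (u ∘ e)) v :=
  Fintype.sum_equiv (Equiv.permCongr e) _ _ fun σ => by
    rw [Equiv.Perm.sign_permCongr]
    congr 2
    funext n
    simp

theorem nsmul_altSum_of_eq_sum_perm {R : Type*} [Monoid R] [DistribMulAction R A]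
    (ext : Equiv.Perm κ → Equiv.Perm ι)
    (hext : ∀ τ, Equiv.Perm.sign (ext τ) = Equiv.Perm.sign τ) {f g : (ι → T) → A} {m : ℕ} {c : R}
    (hg : ∀ u, m • g u = c • ∑ τ, Equiv.Perm.sign τ • f (u ∘ ext τ)) (v : ι → T) :
    m • altSum g v = c • (Fintype.card κ).factorial • altSum f v := by
  have hreindex : ∀ τ, ∑ σ, Equiv.Perm.sign σ • Equiv.Perm.sign τ • f ((v ∘ σ) ∘ ext τ) =
      altSum f v := fun τ =>
    Fintype.sum_equiv (Equiv.mulRight (ext τ)) _ _ fun σ => by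
      rw [smul_smul, ← hext τ, ← map_mul]
      rfl
  rw [smul_altSum, funext hg, ← smul_altSum]
  congr 1
  simp only [altSum, Finset.smul_sum]
  rw [Finset.sum_comm, Finset.sum_congr rfl fun τ _ => hreindex τ, Finset.sum_const,
    Finset.card_univ, Fintype.card_perm, altSum, Finset.smul_sum]

end AltSum

section WedgeAssoc

variable {T W : Type*} [AddCommGroup T] [Module ℝ T] [AddCommGroup W] [Module ℝ W]

theorem factorial_smul_coe_fibreWedge {i j k l : ℕ} (α : T [⋀^Fin i]→ₗ[ℝ] ⋀[ℝ]^j W)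
    (β : T [⋀^Fin k]→ₗ[ℝ] ⋀[ℝ]^l W) (v : Fin (i + k) → T) :
    (i.factorial * k.factorial) • (fibreWedge α β v : ExteriorAlgebra ℝ W) =
      ((-1 : ℝ) ^ (j * k)) • altSum (fun u => (α (u ∘ Fin.castAdd k) : ExteriorAlgebra ℝ W) *
        (β (u ∘ Fin.natAdd i) : ExteriorAlgebra ℝ W)) v := by
  let mul : ⋀[ℝ]^j W ⊗[ℝ] ⋀[ℝ]^l W →ₗ[ℝ] ExteriorAlgebra ℝ W :=
    Submodule.subtype _ ∘ₗ TensorProduct.lift (extMul j l)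
  have hcoprod : (i.factorial * k.factorial) • (α.domCoprod β) (v ∘ finSumFinEquiv) =
      ∑ σ : Equiv.Perm (Fin i ⊕ Fin k), Equiv.Perm.sign σ •
        ((α fun n => v (finSumFinEquiv (σ (Sum.inl n)))) ⊗ₜ[ℝ]
          (β fun n => v (finSumFinEquiv (σ (Sum.inr n))))) := by
    have h := DFunLike.congr_fun (MultilinearMap.domCoprod_alternization_eq α β)
      (v ∘ finSumFinEquiv)
    simp only [Fintype.card_fin] at h
    exact h.symm.trans (MultilinearMap.alternatization_apply _ _)
  calc (i.factorial * k.factorial) • (fibreWedge α β v : ExteriorAlgebra ℝ W)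
      = ((-1 : ℝ) ^ (j * k)) •
          mul ((i.factorial * k.factorial) • (α.domCoprod β) (v ∘ finSumFinEquiv)) := by
        rw [map_nsmul, smul_comm]; rfl
    _ = _ := by
        rw [hcoprod, map_sum, altSum]
        congr 1
        refine Fintype.sum_equiv (Equiv.permCongr finSumFinEquiv) _ _ fun σ => ?_
        rw [Units.smul_def, map_zsmul, Equiv.Perm.sign_permCongr, Units.smul_def]
        congr 2
        simp only [mul, LinearMap.comp_apply, TensorProduct.lift.tmul, Submodule.subtype_apply]
        change (α _ : ExteriorAlgebra ℝ W) * β _ = _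
        congr 3 <;> funext n <;> simp [Equiv.permCongr_apply]

variable {i j k l p q : ℕ} (α : T [⋀^Fin i]→ₗ[ℝ] ⋀[ℝ]^j W) (β : T [⋀^Fin k]→ₗ[ℝ] ⋀[ℝ]^l W)
  (γ : T [⋀^Fin p]→ₗ[ℝ] ⋀[ℝ]^q W)

instance isAddTorsionFree_exteriorAlgebra : IsAddTorsionFree (ExteriorAlgebra ℝ W) :=
  .of_isTorsionFree ℝ _

theorem factorial_smul_coe_fibreWedge_fibreWedge_left (v : Fin (i + k + p) → T) :
    (i.factorial * k.factorial * p.factorial) •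
        (fibreWedge (fibreWedge α β) γ v : ExteriorAlgebra ℝ W) =
      ((-1 : ℝ) ^ (j * k + (j + l) * p)) •
        altSum (fun u => (α fun n => u (Fin.castAdd p (Fin.castAdd k n)) : ExteriorAlgebra ℝ W) *
          (β fun n => u (Fin.castAdd p (Fin.natAdd i n)) : ExteriorAlgebra ℝ W) *
          (γ fun n => u (Fin.natAdd (i + k) n) : ExteriorAlgebra ℝ W)) v := by
  set f : (Fin (i + k + p) → T) → ExteriorAlgebra ℝ W := fun u => _
  let ext (τ : Equiv.Perm (Fin (i + k))) : Equiv.Perm (Fin (i + k + p)) :=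
    finSumFinEquiv.permCongr (τ.sumCongr 1)
  have hext : ∀ τ, Equiv.Perm.sign (ext τ) = Equiv.Perm.sign τ := fun τ => by
    simp [ext, Equiv.Perm.sign_permCongr, Equiv.Perm.sign_sumCongr]
  have hinner : ∀ u : Fin (i + k + p) → T, (i.factorial * k.factorial) •
      ((fibreWedge α β (u ∘ Fin.castAdd p) : ExteriorAlgebra ℝ W) * γ (u ∘ Fin.natAdd (i + k))) =
        ((-1 : ℝ) ^ (j * k)) • ∑ τ, Equiv.Perm.sign τ • f (u ∘ ext τ) := fun u => by
    rw [← smul_mul_assoc, factorial_smul_coe_fibreWedge, smul_mul_assoc, altSum, Finset.sum_mul]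
    congr 1
    refine Finset.sum_congr rfl fun τ _ => ?_
    rw [smul_mul_assoc]
    simp only [f, ext]
    congr 4 <;> simp [Function.comp_def, Equiv.permCongr_apply]
  refine nsmul_right_injective (i + k).factorial_ne_zero ?_
  have hregroup : (i + k).factorial * (i.factorial * k.factorial * p.factorial) =
      i.factorial * k.factorial * ((i + k).factorial * p.factorial) := by ring
  dsimp only
  rw [smul_smul, hregroup, mul_smul, factorial_smul_coe_fibreWedge, smul_comm,
    nsmul_altSum_of_eq_sum_perm ext hext hinner, Fintype.card_fin, smul_smul, ← pow_add,
    add_comm ((j + l) * p), smul_comm]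

theorem factorial_smul_coe_fibreWedge_fibreWedge_right (v : Fin (i + (k + p)) → T) :
    (i.factorial * k.factorial * p.factorial) •
        (fibreWedge α (fibreWedge β γ) v : ExteriorAlgebra ℝ W) =
      ((-1 : ℝ) ^ (j * k + (j + l) * p)) •
        altSum (fun u => (α fun n => u (Fin.castAdd (k + p) n) : ExteriorAlgebra ℝ W) *
          (β fun n => u (Fin.natAdd i (Fin.castAdd p n)) : ExteriorAlgebra ℝ W) *
          (γ fun n => u (Fin.natAdd i (Fin.natAdd k n)) : ExteriorAlgebra ℝ W)) v := by
  set f : (Fin (i + (k + p)) → T) → ExteriorAlgebra ℝ W := fun u => _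
  let ext (τ : Equiv.Perm (Fin (k + p))) : Equiv.Perm (Fin (i + (k + p))) :=
    finSumFinEquiv.permCongr (Equiv.Perm.sumCongr 1 τ)
  have hext : ∀ τ, Equiv.Perm.sign (ext τ) = Equiv.Perm.sign τ := fun τ => by
    simp [ext, Equiv.Perm.sign_permCongr, Equiv.Perm.sign_sumCongr]
  have hinner : ∀ u : Fin (i + (k + p)) → T, (k.factorial * p.factorial) •
      ((α (u ∘ Fin.castAdd (k + p)) : ExteriorAlgebra ℝ W) * fibreWedge β γ (u ∘ Fin.natAdd i)) =
        ((-1 : ℝ) ^ (l * p)) • ∑ τ, Equiv.Perm.sign τ • f (u ∘ ext τ) := fun u => by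
    rw [← mul_smul_comm, factorial_smul_coe_fibreWedge, mul_smul_comm, altSum, Finset.mul_sum]
    congr 1
    refine Finset.sum_congr rfl fun τ _ => ?_
    rw [mul_smul_comm, ← mul_assoc]
    simp only [f, ext]
    congr 4 <;> simp [Function.comp_def, Equiv.permCongr_apply]
  refine nsmul_right_injective (k + p).factorial_ne_zero ?_
  have hregroup : (k + p).factorial * (i.factorial * k.factorial * p.factorial) =
      k.factorial * p.factorial * (i.factorial * (k + p).factorial) := by ring
  have hsign : j * (k + p) + l * p = j * k + (j + l) * p := by ring
  dsimp only
  rw [smul_smul, hregroup, mul_smul, factorial_smul_coe_fibreWedge, smul_comm,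
    nsmul_altSum_of_eq_sum_perm ext hext hinner, Fintype.card_fin, smul_smul, ← pow_add,
    hsign, smul_comm]

theorem coe_fibreWedge_assoc (v : Fin (i + k + p) → T) :
    (fibreWedge (fibreWedge α β) γ v : ExteriorAlgebra ℝ W) =
      fibreWedge α (fibreWedge β γ) (v ∘ Fin.cast (add_assoc i k p).symm) := by
  have hfactorial : i.factorial * k.factorial * p.factorial ≠ 0 := by positivity
  refine nsmul_right_injective hfactorial ?_
  dsimp only
  rw [factorial_smul_coe_fibreWedge_fibreWedge_left,
    factorial_smul_coe_fibreWedge_fibreWedge_right]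
  congr 1
  refine Eq.trans ?_ (altSum_comp_equiv (finCongr (add_assoc i k p).symm) _ v).symm
  have hnat : ∀ n, Fin.natAdd (i + k) n = finCongr (add_assoc i k p).symm
      (Fin.natAdd i (Fin.natAdd k n)) := fun n => Fin.ext (add_assoc i k n)
  simp only [hnat]
  rfl

theorem coe_fibreWedge_one_one (α : T [⋀^Fin 1]→ₗ[ℝ] ⋀[ℝ]^j W) (β : T [⋀^Fin 1]→ₗ[ℝ] ⋀[ℝ]^l W)
    (v : Fin (1 + 1) → T) :
    (fibreWedge α β v : ExteriorAlgebra ℝ W) = (-1 : ℝ) ^ j •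
      ((α fun _ => v 0 : ExteriorAlgebra ℝ W) * (β fun _ => v 1) -
        (α fun _ => v 1 : ExteriorAlgebra ℝ W) * (β fun _ => v 0)) := by
  have hperm : (Finset.univ : Finset (Equiv.Perm (Fin (1 + 1)))) = {1, Equiv.swap 0 1} := by decide
  have hcast : ∀ σ : Equiv.Perm (Fin (1 + 1)),
      (v ∘ σ) ∘ Fin.castAdd 1 = (fun _ => v (σ 0)) ∧
        (v ∘ σ) ∘ Fin.natAdd 1 = fun _ => v (σ 1) := fun σ =>
    ⟨funext fun n => by rw [Subsingleton.elim n 0]; rfl,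
      funext fun n => by rw [Subsingleton.elim n 0]; rfl⟩
  have h := factorial_smul_coe_fibreWedge α β v
  simp only [Nat.factorial_one, mul_one, one_smul] at h
  rw [h, altSum, hperm, Finset.sum_pair (by decide)]
  simp only [hcast, Equiv.Perm.sign_one, one_smul, Equiv.Perm.sign_swap (zero_ne_one' (Fin 2)),
    Units.neg_smul, Equiv.swap_apply_left, Equiv.swap_apply_right, Equiv.Perm.one_apply,
    sub_eq_add_neg]

theorem coe_eq_ι_oneEquiv (w : ⋀[ℝ]^1 W) :
    (w : ExteriorAlgebra ℝ W) = ExteriorAlgebra.ι ℝ (exteriorPower.oneEquiv ℝ W w) := by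
  obtain ⟨u, rfl⟩ := (exteriorPower.oneEquiv ℝ W).symm.surjective w
  simp [exteriorPower.oneEquiv_symm_apply, ExteriorAlgebra.ιMulti_apply]

variable {e b : T [⋀^Fin 1]→ₗ[ℝ] ⋀[ℝ]^1 W}

theorem fibreWedge_one_one_comm : fibreWedge e b = fibreWedge b e := by
  have hanti : ∀ u v, (e u : ExteriorAlgebra ℝ W) * b v = -(b v * e u) := fun u v => by
    rw [coe_eq_ι_oneEquiv (e u), coe_eq_ι_oneEquiv (b v), ι_mul_ι_comm]
  refine AlternatingMap.ext fun v => Subtype.ext ?_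
  rw [coe_fibreWedge_one_one, coe_fibreWedge_one_one, hanti, hanti]
  congr 1
  abel

theorem coe_fibreWedge_fibreWedge_left_comm (a : T [⋀^Fin k]→ₗ[ℝ] ⋀[ℝ]^l W)
    (v : Fin (1 + 1 + k) → T) :
    (fibreWedge (fibreWedge e b) a v : ExteriorAlgebra ℝ W) =
      fibreWedge b (fibreWedge e a) (v ∘ Fin.cast (add_assoc 1 1 k).symm) := by
  rw [fibreWedge_one_one_comm, coe_fibreWedge_assoc]

theorem eq_zero_of_fibreWedge_eq_zero [Module.Finite ℝ T] (hT : 3 ≤ Module.finrank ℝ T)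
    (he : Function.Injective fun v => e fun _ => v) (h : fibreWedge e b = 0) : b = 0 := by
  let toLinear (c : T [⋀^Fin 1]→ₗ[ℝ] ⋀[ℝ]^1 W) : T →ₗ[ℝ] W :=
    (exteriorPower.oneEquiv ℝ W).toLinearMap ∘ₗ (AlternatingMap.ofSubsingleton ℝ T _ 0).symm c
  have hι : ∀ c u, (c fun _ => u : ExteriorAlgebra ℝ W) = ExteriorAlgebra.ι ℝ (toLinear c u) :=
    fun c u => coe_eq_ι_oneEquiv _
  have hsymm : ∀ u v, ExteriorAlgebra.ι ℝ (toLinear e u) * ExteriorAlgebra.ι ℝ (toLinear b v) =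
      ExteriorAlgebra.ι ℝ (toLinear e v) * ExteriorAlgebra.ι ℝ (toLinear b u) := fun u v => by
    have huv := coe_fibreWedge_one_one e b ![u, v]
    rw [h, hι, hι, hι, hι] at huv
    exact sub_eq_zero.1 ((smul_eq_zero.1 huv.symm).resolve_left (by simp))
  have hinj : Function.Injective (toLinear e) :=
    (exteriorPower.oneEquiv ℝ W).injective.comp he
  have hb : toLinear b = 0 := eq_zero_of_forall_ι_mul_ι_eq hT hinj hsymm
  have hval : ∀ u, b (fun _ => u) = 0 := fun u => Subtype.ext (by rw [hι, hb]; simp)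
  exact AlternatingMap.ext fun v =>
    (congrArg b (funext fun n => congrArg v (Subsingleton.elim n 0))).trans (hval (v 0))

end WedgeAssoc

section Duality

theorem surjective_of_adjoint_eq_zero {K X X' Y Y' : Type*} [Field K]
    [AddCommGroup X] [Module K X] [AddCommGroup X'] [Module K X'] [AddCommGroup Y] [Module K Y]
    [AddCommGroup Y'] [Module K Y'] [FiniteDimensional K Y'] {P : Y' →ₗ[K] Y →ₗ[K] K}
    {Q : X' →ₗ[K] X →ₗ[K] K} {A : X →ₗ[K] Y} {A' : Y' →ₗ[K] X'}
    (hadj : ∀ b a, P b (A a) = Q (A' b) a) (hP : P.SeparatingRight) (hQ : Q.SeparatingLeft)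
    (hA' : ∀ b, A' b = 0 → b = 0) : Function.Surjective A := by
  have hPinj : Function.Injective P.flip := LinearMap.ker_eq_bot.1
    (LinearMap.separatingRight_iff_flip_ker_eq_bot.1 hP)
  have : FiniteDimensional K Y := FiniteDimensional.of_injective P.flip hPinj
  let restrict : Y' →ₗ[K] Module.Dual K (LinearMap.range A) :=
    (Submodule.subtype (LinearMap.range A)).dualMap ∘ₗ P
  have hrestrict : Function.Injective restrict := by
    refine (injective_iff_map_eq_zero restrict).2 fun b hb => ?_
    refine hA' b (hQ _ fun a => ?_)
    rw [← hadj]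
    exact LinearMap.congr_fun hb ⟨A a, a, rfl⟩
  refine LinearMap.range_eq_top.1 (Submodule.eq_top_of_finrank_eq (le_antisymm
    (Submodule.finrank_le _) ?_))
  calc Module.finrank K Y ≤ Module.finrank K (Module.Dual K Y') :=
        LinearMap.finrank_le_finrank_of_injective hPinj
    _ = Module.finrank K Y' := Subspace.dual_finrank_eq
    _ ≤ Module.finrank K (Module.Dual K (LinearMap.range A)) :=
        LinearMap.finrank_le_finrank_of_injective hrestrict
    _ = Module.finrank K (LinearMap.range A) := Subspace.dual_finrank_eq

variable {T W : Type*} [AddCommGroup T] [Module ℝ T] [AddCommGroup W] [Module ℝ W]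

theorem add_fibreWedge {i j k l : ℕ} (α γ : T [⋀^Fin i]→ₗ[ℝ] ⋀[ℝ]^j W)
    (β : T [⋀^Fin k]→ₗ[ℝ] ⋀[ℝ]^l W) :
    fibreWedge (α + γ) β = fibreWedge α β + fibreWedge γ β := by
  ext1 v
  simp only [fibreWedge_apply, AlternatingMap.add_apply, map_add, LinearMap.add_apply, smul_add,
    Finset.sum_add_distrib]

theorem smul_fibreWedge {i j k l : ℕ} (c : ℝ) (α : T [⋀^Fin i]→ₗ[ℝ] ⋀[ℝ]^j W)
    (β : T [⋀^Fin k]→ₗ[ℝ] ⋀[ℝ]^l W) : fibreWedge (c • α) β = c • fibreWedge α β := by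
  ext1 v
  simp only [fibreWedge_apply, AlternatingMap.smul_apply, map_smul, LinearMap.smul_apply,
    smul_comm _ c, ← Finset.smul_sum]

/-- The wedge product on the fibres as a bilinear map. -/
def fibreWedgeₗ (T W : Type*) [AddCommGroup T] [Module ℝ T] [AddCommGroup W] [Module ℝ W]
    (i j k l : ℕ) : (T [⋀^Fin i]→ₗ[ℝ] ⋀[ℝ]^j W) →ₗ[ℝ] (T [⋀^Fin k]→ₗ[ℝ] ⋀[ℝ]^l W) →ₗ[ℝ]
      (T [⋀^Fin (i + k)]→ₗ[ℝ] ⋀[ℝ]^(j + l) W) :=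
  LinearMap.mk₂ ℝ fibreWedge add_fibreWedge smul_fibreWedge fibreWedge_add fibreWedge_smul

instance finiteDimensional_alternatingMap [FiniteDimensional ℝ T] [FiniteDimensional ℝ W] {i : ℕ} :
    FiniteDimensional ℝ (T [⋀^Fin i]→ₗ[ℝ] W) :=
  exteriorPower.alternatingMapLinearEquiv.symm.finiteDimensional

theorem finrank_alternatingMap [FiniteDimensional ℝ T] [FiniteDimensional ℝ W] (i : ℕ) :
    Module.finrank ℝ (T [⋀^Fin i]→ₗ[ℝ] W) =
      (Module.finrank ℝ T).choose i * Module.finrank ℝ W := by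
  rw [exteriorPower.alternatingMapLinearEquiv.finrank_eq, Module.finrank_linearMap,
    exteriorPower.finrank_eq]

theorem exists_injective_functional [FiniteDimensional ℝ T] [FiniteDimensional ℝ W] {n : ℕ}
    (hT : Module.finrank ℝ T = n) (hW : Module.finrank ℝ W = 1) :
    ∃ φ : (T [⋀^Fin n]→ₗ[ℝ] W) →ₗ[ℝ] ℝ, Function.Injective φ := by
  have hone : Module.finrank ℝ (T [⋀^Fin n]→ₗ[ℝ] W) = Module.finrank ℝ ℝ := by
    rw [finrank_alternatingMap, hT, hW, Nat.choose_self, mul_one, Module.finrank_self]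
  exact ⟨LinearEquiv.ofFinrankEq _ _ hone, LinearEquiv.injective _⟩

variable [FiniteDimensional ℝ T] [FiniteDimensional ℝ W] {i j k l : ℕ}
  {φ : (T [⋀^Fin (i + k)]→ₗ[ℝ] ⋀[ℝ]^(j + l) W) →ₗ[ℝ] ℝ}

theorem separatingLeft_fibreWedgeₗ (hφ : Function.Injective φ)
    (hT : Module.finrank ℝ T = i + k) (hW : j + l ≤ Module.finrank ℝ W) :
    ((fibreWedgeₗ T W i j k l).compr₂ φ).SeparatingLeft := fun α hα => by
  by_contra hne
  obtain ⟨β, hβ⟩ := exists_fibreWedge_right_ne_zero (l := l) hT hW hne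
  exact hβ (hφ ((hα β).trans φ.map_zero.symm))

theorem separatingRight_fibreWedgeₗ (hφ : Function.Injective φ)
    (hT : Module.finrank ℝ T = i + k) (hW : j + l ≤ Module.finrank ℝ W) :
    ((fibreWedgeₗ T W i j k l).compr₂ φ).SeparatingRight := fun β hβ => by
  by_contra hne
  obtain ⟨α, hα⟩ := exists_fibreWedge_left_ne_zero (j := j) hT hW hne
  exact hα (hφ ((hβ α).trans φ.map_zero.symm))

/-- By associativity, `e ∧ ·` on `Ω^{1,2}` is adjoint to `e ∧ ·` on `Ω^{1,1}` under the perfect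
wedge pairings, so the injectivity of the latter gives the surjectivity of the former. -/
theorem fibreWedge_surjective (hT : Module.finrank ℝ T = 3) (hW : Module.finrank ℝ W = 4)
    {e : T [⋀^Fin 1]→ₗ[ℝ] ⋀[ℝ]^1 W} (he : Function.Injective fun v => e fun _ => v) :
    Function.Surjective (fibreWedgeₗ T W 1 1 1 2 e) := by
  have htop : Module.finrank ℝ (⋀[ℝ]^4 W) = 1 := by
    rw [exteriorPower.finrank_eq, hW, Nat.choose_self]
  obtain ⟨φ, hφ⟩ := exists_injective_functional (T := T) hT htop
  let P := (fibreWedgeₗ T W 1 1 (1 + 1) (1 + 2)).compr₂ φ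
  let Q := (fibreWedgeₗ T W (1 + 1) (1 + 1) 1 2).compr₂ φ
  have hP : P.SeparatingRight := separatingRight_fibreWedgeₗ hφ hT hW.ge
  have hQ : Q.SeparatingLeft := separatingLeft_fibreWedgeₗ hφ hT hW.ge
  have hadj : ∀ b a, P b (fibreWedgeₗ T W 1 1 1 2 e a) = Q (fibreWedgeₗ T W 1 1 1 1 e b) a :=
    fun b a => congrArg φ (AlternatingMap.ext fun v => Subtype.ext
      (coe_fibreWedge_fibreWedge_left_comm a v).symm)
  have hinj : ∀ b, fibreWedgeₗ T W 1 1 1 1 e b = 0 → b = 0 :=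
    fun b => eq_zero_of_fibreWedge_eq_zero hT.ge he
  exact surjective_of_adjoint_eq_zero (X := T [⋀^Fin 1]→ₗ[ℝ] ⋀[ℝ]^2 W)
    (X' := T [⋀^Fin (1 + 1)]→ₗ[ℝ] ⋀[ℝ]^(1 + 1) W) (Y := T [⋀^Fin (1 + 1)]→ₗ[ℝ] ⋀[ℝ]^(1 + 2) W)
    (Y' := T [⋀^Fin 1]→ₗ[ℝ] ⋀[ℝ]^1 W) hadj hP hQ hinj

end Duality

section SmoothDual

variable {𝕜 : Type*} [NontriviallyNormedField 𝕜] {H EM : Type*} [TopologicalSpace H]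
  [NormedAddCommGroup EM] [NormedSpace 𝕜 EM] {I : ModelWithCorners 𝕜 EM H} {r : WithTop ℕ∞}
  {S : Type*} [TopologicalSpace S] [ChartedSpace H S] {U : Set S}

theorem contMDiffOn_dual_of_span_eq_top {N : Type*} [AddCommMonoid N] [Module 𝕜 N] {s : Set N}
    (hs : Submodule.span 𝕜 s = ⊤) {G : S → Module.Dual 𝕜 N}
    (hG : ∀ u ∈ s, ContMDiffOn I 𝓘(𝕜) r (fun x => G x u) U) (u : N) :
    ContMDiffOn I 𝓘(𝕜) r (fun x => G x u) U := by
  have hu : u ∈ Submodule.span 𝕜 s := hs ▸ Submodule.mem_top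
  induction hu using Submodule.span_induction with
  | mem u hu => exact hG u hu
  | zero => simpa using contMDiffOn_const
  | add u v _ _ hu hv =>
    simp only [map_add]
    exact hu.add hv
  | smul c u _ hu =>
    simp only [map_smul, smul_eq_mul]
    exact contMDiffOn_const.mul hu

variable [CompleteSpace 𝕜] {E : Type*} [NormedAddCommGroup E] [NormedSpace 𝕜 E]
  [FiniteDimensional 𝕜 E]

theorem contMDiffOn_linearMap_comp {E' : Type*} [NormedAddCommGroup E'] [NormedSpace 𝕜 E']
    (l : E →ₗ[𝕜] E') {f : S → E} (hf : ContMDiffOn I 𝓘(𝕜, E) r f U) :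
    ContMDiffOn I 𝓘(𝕜, E') r (fun x => l (f x)) U :=
  l.toContinuousLinearMap.contMDiff.comp_contMDiffOn hf

theorem contMDiffOn_dual_multilinearMap {n : ℕ} {N : Type*} [AddCommMonoid N] [Module 𝕜 N]
    {G : S → Module.Dual 𝕜 N} (hG : ∀ u, ContMDiffOn I 𝓘(𝕜) r (fun x => G x u) U)
    (m : MultilinearMap 𝕜 (fun _ : Fin n => E) N) {f : Fin n → S → E}
    (hf : ∀ k, ContMDiffOn I 𝓘(𝕜, E) r (f k) U) :
    ContMDiffOn I 𝓘(𝕜) r (fun x => G x (m fun k => f k x)) U := by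
  let b := Module.finBasis 𝕜 E
  have hexpand : ∀ x, G x (m fun k => f k x) = ∑ c : Fin n → Fin (Module.finrank 𝕜 E),
      (∏ k, b.coord (c k) (f k x)) * G x (m fun k => b (c k)) := fun x => by
    conv_lhs => rw [show (fun k => f k x) = fun k => ∑ t, b.coord t (f k x) • b t from
      funext fun k => (b.sum_repr (f k x)).symm]
    simp only [m.map_sum, m.map_smul_univ, map_sum, map_smul, smul_eq_mul]
  refine ContMDiffOn.congr ?_ fun x _ => hexpand x
  exact contMDiffOn_finsetSum fun c _ => (contMDiffOn_finsetProd fun k _ =>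
    contMDiffOn_linearMap_comp (b.coord (c k)) (hf k)).mul (hG _)

end SmoothDual

section ModelForm

/-- The model of the fibre of `Λ^i T^*S ⊗ ⋀^j V`. -/
abbrev ModelForm (i j : ℕ) : Type := E3 [⋀^Fin i]→ₗ[ℝ] ⋀[ℝ]^j F4

instance (i j : ℕ) : Module.Free ℝ (ModelForm i j) :=
  Module.Free.of_divisionRing (K := ℝ) (V := ModelForm i j)

/-- The functional `a ↦ l (a v)` on model forms. -/
def evalDual {i j : ℕ} (v : Fin i → E3) (l : Module.Dual ℝ (⋀[ℝ]^j F4)) :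
    Module.Dual ℝ (ModelForm i j) where
  toFun a := l (a v)
  map_add' a b := by simp
  map_smul' c a := by simp

theorem span_range_evalDual (i j : ℕ) : Submodule.span ℝ (Set.range fun p :
    (Fin i → E3) × Module.Dual ℝ (⋀[ℝ]^j F4) => evalDual (i := i) p.1 p.2) = ⊤ := by
  set s := Set.range fun p : (Fin i → E3) × Module.Dual ℝ (⋀[ℝ]^j F4) => evalDual (i := i) p.1 p.2
  have : FiniteDimensional ℝ (Module.Dual ℝ (ModelForm i j)) :=
    Subspace.instModuleDualFiniteDimensional (K := ℝ) (V := ModelForm i j)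
  have hbot : (Submodule.span ℝ s).dualCoannihilator = ⊥ := by
    refine eq_bot_iff.2 fun a ha => (Submodule.mem_bot ℝ).2 (AlternatingMap.ext fun v => ?_)
    exact (Module.forall_dual_apply_eq_zero_iff ℝ _).1 fun l =>
      (Submodule.mem_dualCoannihilator a).1 ha _ (Submodule.subset_span ⟨(v, l), rfl⟩)
  have h : (Submodule.span ℝ s).dualCoannihilator.dualAnnihilator = Submodule.span ℝ s :=
    Subspace.dualCoannihilator_dualAnnihilator_eq (K := ℝ) (V := ModelForm i j)
  rw [← h, hbot, Submodule.dualAnnihilator_bot]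

variable {T T' W W' : Type*} [AddCommGroup T] [Module ℝ T] [AddCommGroup T'] [Module ℝ T']
  [AddCommGroup W] [Module ℝ W] [AddCommGroup W'] [Module ℝ W'] {i j : ℕ}

/-- The map on alternating maps with values in an exterior power which is induced by linear maps of
the arguments (contravariant) and of the values (covariant). -/
def alternatingMapMap (f : W →ₗ[ℝ] W') (g : T' →ₗ[ℝ] T) :
    (T [⋀^Fin i]→ₗ[ℝ] ⋀[ℝ]^j W) →ₗ[ℝ] (T' [⋀^Fin i]→ₗ[ℝ] ⋀[ℝ]^j W') where
  toFun α := (exteriorPower.map j f).compAlternatingMap (α.compLinearMap g)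
  map_add' α β := by ext1 v; simp
  map_smul' c α := by ext1 v; simp

theorem alternatingMapMap_alternatingMapMap {f : W →ₗ[ℝ] W'} {f' : W' →ₗ[ℝ] W} {g : T' →ₗ[ℝ] T}
    {g' : T →ₗ[ℝ] T'} (hf : ∀ w, f' (f w) = w) (hg : ∀ t, g (g' t) = t)
    (α : T [⋀^Fin i]→ₗ[ℝ] ⋀[ℝ]^j W) :
    alternatingMapMap f' g' (alternatingMapMap f g α) = α := by
  refine AlternatingMap.ext fun v => ?_
  have hcomp : f' ∘ₗ f = LinearMap.id := LinearMap.ext hf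
  change exteriorPower.map j f' (exteriorPower.map j f (α fun n => g (g' (v n)))) = α v
  rw [← LinearMap.comp_apply, ← exteriorPower.map_comp, hcomp, exteriorPower.map_id]
  simp only [hg, LinearMap.id_apply]

end ModelForm

section LocalRepresentation

variable {S : Type*} [TopologicalSpace S] [ChartedSpace E3 S]

theorem contMDiffOn_transition {F : Type*} [NormedAddCommGroup F] [NormedSpace ℝ F]
    (V : S → Type*) [TopologicalSpace (TotalSpace F V)] [∀ x, AddCommGroup (V x)]
    [∀ x, Module ℝ (V x)] [∀ x, TopologicalSpace (V x)] [FiberBundle F V] [VectorBundle ℝ F V]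
    [ContMDiffVectorBundle ∞ F V (𝓡 3)] (x₀ x₁ : S) (w : F) :
    ContMDiffOn (𝓡 3) 𝓘(ℝ, F) ∞ (fun x => (trivializationAt F V x₁).linearMapAt ℝ x
      ((trivializationAt F V x₀).symmₗ ℝ x w))
      ((trivializationAt F V x₀).baseSet ∩ (trivializationAt F V x₁).baseSet) := by
  have h := (contMDiffOn_coordChangeL (IB := 𝓡 3) (n := ∞) (trivializationAt F V x₀)
    (trivializationAt F V x₁)).clm_apply (contMDiffOn_const (c := w))
  refine h.congr fun x hx => ?_
  rw [Trivialization.coe_linearMapAt_of_mem _ hx.2, Trivialization.symmₗ_apply _ hx.1]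
  exact (Trivialization.coordChangeL_apply _ _ hx w).symm

theorem contMDiffOn_map_transition {F : Type*} [NormedAddCommGroup F] [NormedSpace ℝ F]
    [FiniteDimensional ℝ F] (V : S → Type*) [TopologicalSpace (TotalSpace F V)]
    [∀ x, AddCommGroup (V x)] [∀ x, Module ℝ (V x)] [∀ x, TopologicalSpace (V x)]
    [FiberBundle F V] [VectorBundle ℝ F V] [ContMDiffVectorBundle ∞ F V (𝓡 3)] {j : ℕ} (x₀ x₁ : S)
    (l : Module.Dual ℝ (⋀[ℝ]^j F)) (u : ⋀[ℝ]^j F) :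
    ContMDiffOn (𝓡 3) 𝓘(ℝ) ∞ (fun x =>
      l (exteriorPower.map j ((trivializationAt F V x₁).linearMapAt ℝ x)
        (exteriorPower.map j ((trivializationAt F V x₀).symmₗ ℝ x) u)))
      ((trivializationAt F V x₀).baseSet ∩ (trivializationAt F V x₁).baseSet) := by
  refine contMDiffOn_dual_of_span_eq_top (exteriorPower.ιMulti_span ℝ j F)
    (G := fun x => l ∘ₗ exteriorPower.map j ((trivializationAt F V x₁).linearMapAt ℝ x) ∘ₗ
      exteriorPower.map j ((trivializationAt F V x₀).symmₗ ℝ x)) ?_ u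
  rintro _ ⟨w, rfl⟩
  simp only [LinearMap.comp_apply, exteriorPower.map_apply_ιMulti]
  exact contMDiffOn_dual_multilinearMap (G := fun _ => l) (fun _ => contMDiffOn_const)
    (exteriorPower.ιMulti ℝ j (M := F)).toMultilinearMap
    fun k => contMDiffOn_transition V x₀ x₁ (w k)

section Nbhd

variable {V : S → Type*} [TopologicalSpace (TotalSpace F4 V)] [∀ x, TopologicalSpace (V x)]
  [FiberBundle F4 V]

theorem isOpen_nbhd (x₀ : S) : IsOpen (nbhd V x₀) :=
  (chartAt E3 x₀).open_source.inter (trivializationAt F4 V x₀).open_baseSet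

theorem mem_nbhd_self (x₀ : S) : x₀ ∈ nbhd V x₀ :=
  ⟨mem_chart_source E3 x₀, FiberBundle.mem_baseSet_trivializationAt' x₀⟩

end Nbhd

variable [IsManifold (𝓡 3) ∞ S]

theorem mem_tangent_baseSet {x₀ x : S} (hx : x ∈ (chartAt E3 x₀).source) :
    x ∈ (trivializationAt E3 (TangentSpace (𝓡 3) : S → Type _) x₀).baseSet := by
  rwa [TangentBundle.trivializationAt_baseSet]

variable {V : S → Type*} [TopologicalSpace (TotalSpace F4 V)] [∀ x, AddCommGroup (V x)]
  [∀ x, Module ℝ (V x)] [∀ x, TopologicalSpace (V x)] [FiberBundle F4 V] [VectorBundle ℝ F4 V]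
  {i j : ℕ}

variable (V i j) in
/-- The fibre at `x` of `Λ^i T^*S ⊗ ⋀^j V`. -/
abbrev FibreForm (x : S) : Type _ := (TangentSpace (𝓡 3) x) [⋀^Fin i]→ₗ[ℝ] ⋀[ℝ]^j (V x)

/-- The model form representing an element of the fibre at `x` in the chart and the trivialization
at `x₀`. It is a linear equivalence for `x` in `nbhd V x₀`. -/
def localRep (x₀ x : S) : FibreForm V i j x →ₗ[ℝ] ModelForm i j :=
  alternatingMapMap ((trivializationAt F4 V x₀).linearMapAt ℝ x)
    ((trivializationAt E3 (TangentSpace (𝓡 3) : S → Type _) x₀).symmₗ ℝ x)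

/-- The element of the fibre at `x` represented by a model form. -/
def localLift (x₀ x : S) : ModelForm i j →ₗ[ℝ] FibreForm V i j x :=
  alternatingMapMap ((trivializationAt F4 V x₀).symmₗ ℝ x)
    ((trivializationAt E3 (TangentSpace (𝓡 3) : S → Type _) x₀).linearMapAt ℝ x)

theorem component_eq_evalDual (α : RoughForm V i j) (x₀ : S) (v : Fin i → E3)
    (l : Module.Dual ℝ (⋀[ℝ]^j F4)) (x : S) :
    component α x₀ v l x = evalDual v l (localRep x₀ x (α x)) := rfl

variable {x₀ x : S}

theorem localLift_localRep (hx : x ∈ nbhd V x₀) (α : FibreForm V i j x) :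
    localLift x₀ x (localRep x₀ x α) = α :=
  alternatingMapMap_alternatingMapMap (Trivialization.symmₗ_linearMapAt _ hx.2)
    (Trivialization.symmₗ_linearMapAt _ (mem_tangent_baseSet hx.1)) α

theorem localRep_localLift (hx : x ∈ nbhd V x₀) (a : ModelForm i j) :
    localRep x₀ x (localLift (V := V) x₀ x a) = a :=
  alternatingMapMap_alternatingMapMap (Trivialization.linearMapAt_symmₗ _ hx.2)
    (Trivialization.linearMapAt_symmₗ _ (mem_tangent_baseSet hx.1)) a

theorem Form.contMDiffOn_dual (α : Form V i j) (x₀ : S) (φ : Module.Dual ℝ (ModelForm i j)) :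
    ContMDiffOn (𝓡 3) 𝓘(ℝ) ∞ (fun x => φ (localRep x₀ x (α.val x))) (nbhd V x₀) := by
  refine contMDiffOn_dual_of_span_eq_top (span_range_evalDual i j)
    (G := fun x => Module.Dual.eval ℝ _ (localRep x₀ x (α.val x))) ?_ φ
  rintro _ ⟨p, rfl⟩
  exact α.smooth x₀ p.1 p.2

theorem contMDiffOn_smul_component {f : S → ℝ} (hf : ContMDiff (𝓡 3) 𝓘(ℝ) ∞ f)
    {α : RoughForm V i j} {v : Fin i → E3} {l : Module.Dual ℝ (⋀[ℝ]^j F4)} {U : Set S}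
    (hα : ContMDiffOn (𝓡 3) 𝓘(ℝ) ∞ (component α x₀ v l) U) :
    ContMDiffOn (𝓡 3) 𝓘(ℝ) ∞ (component (fun x => f x • α x) x₀ v l) U := by
  refine (hf.contMDiffOn.mul hα).congr fun x _ => ?_
  rw [component_eq_evalDual, map_smul, map_smul]
  rfl

/-- The product of a form with a smooth function. -/
def functionSmul (f : S → ℝ) (hf : ContMDiff (𝓡 3) 𝓘(ℝ) ∞ f) (α : Form V i j) :
    Form V i j where
  val x := f x • α.val x
  smooth x₀ v l := contMDiffOn_smul_component hf (α.smooth x₀ v l)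

variable [ContMDiffVectorBundle ∞ F4 V (𝓡 3)]

theorem contMDiffOn_component_localLift (x₀ x₁ : S) (a : ModelForm i j) (v : Fin i → E3)
    (l : Module.Dual ℝ (⋀[ℝ]^j F4)) :
    ContMDiffOn (𝓡 3) 𝓘(ℝ) ∞ (component (fun x => localLift (V := V) x₀ x a) x₁ v l)
      (nbhd V x₀ ∩ nbhd V x₁) :=
  contMDiffOn_dual_multilinearMap
    (G := fun x => l ∘ₗ exteriorPower.map j ((trivializationAt F4 V x₁).linearMapAt ℝ x) ∘ₗ
      exteriorPower.map j ((trivializationAt F4 V x₀).symmₗ ℝ x))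
    (fun u => (contMDiffOn_map_transition V x₀ x₁ l u).mono fun _ hx => ⟨hx.1.2, hx.2.2⟩)
    a.toMultilinearMap fun k =>
      (contMDiffOn_transition (TangentSpace (𝓡 3) : S → Type _) x₁ x₀ (v k)).mono
        fun _ hx => ⟨mem_tangent_baseSet hx.2.1, mem_tangent_baseSet hx.1.1⟩

/-- A model form, transported to the fibres near `x₀` and multiplied by a cut-off function. -/
def cutoffForm (x₀ : S) (f : S → ℝ) (hf : ContMDiff (𝓡 3) 𝓘(ℝ) ∞ f)
    (hs : tsupport f ⊆ nbhd V x₀) (a : ModelForm i j) : Form V i j where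
  val x := f x • localLift x₀ x a
  smooth x₁ v l x hx := by
    by_cases hxs : x ∈ tsupport f
    · have hsmooth := contMDiffOn_smul_component hf
        (contMDiffOn_component_localLift (V := V) x₀ x₁ a v l)
      have hmem := ((isOpen_nbhd x₀).inter (isOpen_nbhd x₁)).mem_nhds ⟨hs hxs, hx⟩
      exact (hsmooth.contMDiffAt hmem).contMDiffWithinAt
    · refine ContMDiffAt.contMDiffWithinAt ?_
      refine (contMDiffAt_const (c := (0 : ℝ))).congr_of_eventuallyEq ?_
      filter_upwards [notMem_tsupport_iff_eventuallyEq.1 hxs] with y hy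
      rw [component_eq_evalDual, hy, Pi.zero_apply, zero_smul, map_zero, map_zero]

end LocalRepresentation

section UniformlySmall

variable {𝕜 : Type*} [NontriviallyNormedField 𝕜] {E : Type*} [NormedAddCommGroup E]
  [NormedSpace 𝕜 E] {ι : Type*} {𝓁 : Filter ι} {Ω : Set E}

variable (𝕜) in
/-- A family of functions all of whose derivatives tend to zero along `𝓁`, uniformly on the compact
subsets of `Ω`. -/
def UniformlySmall {F : Type*} [NormedAddCommGroup F] [NormedSpace 𝕜 F] (𝓁 : Filter ι) (Ω : Set E)
    (h : ι → E → F) : Prop :=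
  ∀ (k : ℕ) (K : Set E), IsCompact K → K ⊆ Ω → ∀ ε > 0, ∀ᶠ a in 𝓁, ∀ y ∈ K,
    ‖iteratedFDerivWithin 𝕜 k (h a) Ω y‖ < ε

section Add

variable {F : Type*} [NormedAddCommGroup F] [NormedSpace 𝕜 F] {h h' : ι → E → F}

theorem UniformlySmall.congr (hh : UniformlySmall 𝕜 𝓁 Ω h) (e : ∀ a, Set.EqOn (h' a) (h a) Ω) :
    UniformlySmall 𝕜 𝓁 Ω h' := by
  intro k K hK hKΩ ε hε
  filter_upwards [hh k K hK hKΩ ε hε] with a ha y hy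
  rw [iteratedFDerivWithin_congr (e a) (hKΩ hy)]
  exact ha y hy

theorem uniformlySmall_zero : UniformlySmall 𝕜 𝓁 Ω fun _ _ => (0 : F) := by
  intro k K _ _ ε hε
  refine Filter.Eventually.of_forall fun a y _ => ?_
  rw [iteratedFDerivWithin_fun_zero, Pi.zero_apply, norm_zero]
  exact hε

theorem UniformlySmall.add (hΩ : IsOpen Ω) (hh : UniformlySmall 𝕜 𝓁 Ω h)
    (hh' : UniformlySmall 𝕜 𝓁 Ω h') (hs : ∀ a, ContDiffOn 𝕜 ∞ (h a) Ω)
    (hs' : ∀ a, ContDiffOn 𝕜 ∞ (h' a) Ω) : UniformlySmall 𝕜 𝓁 Ω fun a y => h a y + h' a y := by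
  intro k K hK hKΩ ε hε
  have hk : (k : WithTop ℕ∞) ≤ ∞ := by exact_mod_cast le_top
  filter_upwards [hh k K hK hKΩ (ε / 2) (by positivity),
    hh' k K hK hKΩ (ε / 2) (by positivity)] with a h₁ h₂ y hy
  calc ‖iteratedFDerivWithin 𝕜 k (h a + h' a) Ω y‖
      = ‖iteratedFDerivWithin 𝕜 k (h a) Ω y + iteratedFDerivWithin 𝕜 k (h' a) Ω y‖ := by
        rw [iteratedFDerivWithin_add_apply ((hs a y (hKΩ hy)).of_le hk)
          ((hs' a y (hKΩ hy)).of_le hk) hΩ.uniqueDiffOn (hKΩ hy)]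
    _ ≤ _ := norm_add_le _ _
    _ < ε / 2 + ε / 2 := add_lt_add (h₁ y hy) (h₂ y hy)
    _ = ε := add_halves ε

theorem UniformlySmall.sum (hΩ : IsOpen Ω) {κ : Type*} (s : Finset κ) {h : κ → ι → E → F}
    (hh : ∀ c, UniformlySmall 𝕜 𝓁 Ω (h c)) (hs : ∀ c a, ContDiffOn 𝕜 ∞ (h c a) Ω) :
    UniformlySmall 𝕜 𝓁 Ω fun a y => ∑ c ∈ s, h c a y := by
  classical
  induction s using Finset.induction_on with
  | empty => simpa only [Finset.sum_empty] using uniformlySmall_zero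
  | insert c s hc ih =>
    simp only [Finset.sum_insert hc]
    exact (hh c).add hΩ ih (hs c) fun a => ContDiffOn.sum fun d _ => hs d a

end Add

theorem UniformlySmall.mul {A : Type*} [NormedRing A] [NormedAlgebra 𝕜 A] (hΩ : IsOpen Ω)
    {g : E → A} {h : ι → E → A} (hg : ContDiffOn 𝕜 ∞ g Ω) (hh : UniformlySmall 𝕜 𝓁 Ω h)
    (hs : ∀ a, ContDiffOn 𝕜 ∞ (h a) Ω) : UniformlySmall 𝕜 𝓁 Ω fun a y => g y * h a y := by
  intro k K hK hKΩ ε hε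
  have hle : ∀ n : ℕ, (n : WithTop ℕ∞) ≤ ∞ := fun n => by exact_mod_cast le_top
  have hterm : ∀ i ∈ Finset.range (k + 1), ∀ᶠ a in 𝓁, ∀ y ∈ K,
      (k.choose i : ℝ) * ‖iteratedFDerivWithin 𝕜 i g Ω y‖ *
        ‖iteratedFDerivWithin 𝕜 (k - i) (h a) Ω y‖ < ε / (k + 1) := by
    intro i _
    obtain ⟨M, hM⟩ := hK.exists_bound_of_continuousOn
      ((hg.continuousOn_iteratedFDerivWithin (hle i) hΩ.uniqueDiffOn).mono hKΩ)
    filter_upwards [hh (k - i) K hK hKΩ (ε / (k + 1) / (k.choose i * |M| + 1)) (by positivity)]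
      with a ha y hy
    calc _ ≤ (k.choose i * |M|) * ‖iteratedFDerivWithin 𝕜 (k - i) (h a) Ω y‖ := by
          gcongr
          exact (hM y hy).trans (le_abs_self M)
      _ ≤ (k.choose i * |M| + 1) * ‖iteratedFDerivWithin 𝕜 (k - i) (h a) Ω y‖ := by
          gcongr
          exact (lt_add_one _).le
      _ < ε / (k + 1) := by
          rw [mul_comm]
          exact (lt_div_iff₀ (by positivity)).1 (ha y hy)
  filter_upwards [(Filter.eventually_all_finset _).2 hterm] with a ha y hy
  calc _ ≤ ∑ i ∈ Finset.range (k + 1), (k.choose i : ℝ) * ‖iteratedFDerivWithin 𝕜 i g Ω y‖ *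
        ‖iteratedFDerivWithin 𝕜 (k - i) (h a) Ω y‖ :=
        norm_iteratedFDerivWithin_mul_le hg (hs a) hΩ.uniqueDiffOn (hKΩ hy) (hle k)
    _ < ∑ _i ∈ Finset.range (k + 1), ε / (k + 1) :=
        Finset.sum_lt_sum_of_nonempty ⟨0, by simp⟩ fun i hi => ha i hi y hy
    _ = ε := by
        rw [Finset.sum_const, Finset.card_range, nsmul_eq_mul]
        push_cast
        field_simp

end UniformlySmall

section FormTopology

variable {S : Type*} [TopologicalSpace S] [ChartedSpace E3 S]

section ChartDomain

variable {V : S → Type*} [TopologicalSpace (TotalSpace F4 V)] [∀ x, TopologicalSpace (V x)]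
  [FiberBundle F4 V] {x₀ : S}

variable (V) in
/-- The coordinate image of the neighbourhood of `x₀` on which local representatives are defined. -/
def chartDomain (x₀ : S) : Set E3 := chartAt E3 x₀ '' nbhd V x₀

theorem isOpen_chartDomain (x₀ : S) : IsOpen (chartDomain V x₀) :=
  (chartAt E3 x₀).isOpen_image_of_subset_source (isOpen_nbhd x₀) Set.inter_subset_left

theorem chartDomain_subset_target : chartDomain V x₀ ⊆ (chartAt E3 x₀).target := by
  rintro _ ⟨x, hx, rfl⟩
  exact (chartAt E3 x₀).map_source hx.1

theorem symm_mem_nbhd {y : E3} (hy : y ∈ chartDomain V x₀) :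
    (chartAt E3 x₀).symm y ∈ nbhd V x₀ := by
  obtain ⟨x, hx, rfl⟩ := hy
  rwa [(chartAt E3 x₀).left_inv hx.1]

theorem contDiffOn_comp_chart_symm [IsManifold (𝓡 3) ∞ S] {g : S → ℝ}
    (hg : ContMDiffOn (𝓡 3) 𝓘(ℝ) ∞ g (nbhd V x₀)) :
    ContDiffOn ℝ ∞ (g ∘ (chartAt E3 x₀).symm) (chartDomain V x₀) := by
  rw [← contMDiffOn_iff_contDiffOn]
  exact hg.comp ((contMDiffOn_chart_symm (I := 𝓡 3) (x := x₀)).mono chartDomain_subset_target)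
    fun y hy => symm_mem_nbhd hy

end ChartDomain

variable [IsManifold (𝓡 3) ∞ S]
  {V : S → Type*} [TopologicalSpace (TotalSpace F4 V)] [∀ x, AddCommGroup (V x)]
  [∀ x, Module ℝ (V x)] [∀ x, TopologicalSpace (V x)] [FiberBundle F4 V] [VectorBundle ℝ F4 V]
  {i j : ℕ}

/-- A functional of the local representative of a form, in coordinates. -/
def localFun (x₀ : S) (φ : Module.Dual ℝ (ModelForm i j)) : Form V i j →ₗ[ℝ] E3 → ℝ where
  toFun α := (fun x => φ (localRep x₀ x (α.val x))) ∘ (chartAt E3 x₀).symm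
  map_add' α β := funext fun y => by simp [val_add]
  map_smul' c α := funext fun y => by simp [val_smul]

theorem contDiffOn_localFun (x₀ : S) (φ : Module.Dual ℝ (ModelForm i j)) (α : Form V i j) :
    ContDiffOn ℝ ∞ (localFun x₀ φ α) (chartDomain V x₀) :=
  contDiffOn_comp_chart_symm (α.contMDiffOn_dual x₀ φ)

theorem dist_iteratedFDeriv_component (α β : Form V i j) (x₀ : S) (v : Fin i → E3)
    (l : Module.Dual ℝ (⋀[ℝ]^j F4)) (k : ℕ) {y : E3} (hy : y ∈ chartDomain V x₀) :
    dist (iteratedFDeriv ℝ k (component β.val x₀ v l ∘ (chartAt E3 x₀).symm) y)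
      (iteratedFDeriv ℝ k (component α.val x₀ v l ∘ (chartAt E3 x₀).symm) y) =
    ‖iteratedFDerivWithin ℝ k (localFun x₀ (evalDual v l) (α - β)) (chartDomain V x₀) y‖ := by
  have hk : (k : WithTop ℕ∞) ≤ ∞ := by exact_mod_cast le_top
  have hΩ := isOpen_chartDomain (V := V) x₀
  rw [map_sub, iteratedFDerivWithin_sub_apply
    ((contDiffOn_localFun x₀ (evalDual v l) α y hy).of_le hk)
    ((contDiffOn_localFun x₀ (evalDual v l) β y hy).of_le hk) hΩ.uniqueDiffOn hy,
    iteratedFDerivWithin_of_isOpen k hΩ hy, iteratedFDerivWithin_of_isOpen k hΩ hy, dist_comm,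
    dist_eq_norm]
  rfl

variable {ι : Type*} {𝓁 : Filter ι} {F : ι → Form V i j} {α : Form V i j}

theorem tendsto_form_iff_evalDual : Filter.Tendsto F 𝓁 (𝓝 α) ↔ ∀ x₀ v l,
    UniformlySmall ℝ 𝓁 (chartDomain V x₀) fun a => localFun x₀ (evalDual v l) (F a - α) := by
  rw [show 𝓝 α = _ from nhds_iInf (a := α)]
  simp only [nhds_iInf, nhds_induced, Filter.tendsto_iInf, Filter.tendsto_comap_iff,
    UniformOnFun.tendsto_iff_tendstoUniformlyOn, Metric.tendstoUniformlyOn_iff]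
  refine forall_congr' fun x₀ => forall_congr' fun v => forall_congr' fun l =>
    forall_congr' fun k => forall_congr' fun K => ⟨fun h hK hKΩ ε hε => ?_, fun h hK ε hε => ?_⟩
  · filter_upwards [h ⟨hK, hKΩ⟩ ε hε] with a ha y hy
    rw [← dist_iteratedFDeriv_component (F a) α x₀ v l k (hKΩ hy)]
    exact ha y hy
  · filter_upwards [h hK.1 hK.2 ε hε] with a ha y hy
    exact (dist_iteratedFDeriv_component (F a) α x₀ v l k (hK.2 hy)).trans_lt (ha y hy)

theorem uniformlySmall_localFun (h : Filter.Tendsto F 𝓁 (𝓝 α)) (x₀ : S)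
    (φ : Module.Dual ℝ (ModelForm i j)) :
    UniformlySmall ℝ 𝓁 (chartDomain V x₀) fun a => localFun x₀ φ (F a - α) := by
  have hφ : φ ∈ Submodule.span ℝ (Set.range _) := span_range_evalDual i j ▸ Submodule.mem_top
  induction hφ using Submodule.span_induction with
  | mem φ hφ =>
    obtain ⟨p, rfl⟩ := hφ
    exact tendsto_form_iff_evalDual.1 h x₀ p.1 p.2
  | zero => exact uniformlySmall_zero
  | add φ ψ _ _ hφ hψ =>
    exact hφ.add (isOpen_chartDomain x₀) hψ (fun a => contDiffOn_localFun x₀ φ _)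
      fun a => contDiffOn_localFun x₀ ψ _
  | smul c φ _ hφ =>
    exact UniformlySmall.mul (isOpen_chartDomain x₀) (contDiffOn_const (c := c)) hφ
      fun a => contDiffOn_localFun x₀ φ _

theorem component_apply_eq_sum {i' j' : ℕ}
    (W : ∀ x : S, FibreForm V i j x →ₗ[ℝ] FibreForm V i' j' x) (α : RoughForm V i j)
    {x₀ x : S} (hx : x ∈ nbhd V x₀) (v : Fin i' → E3) (l : Module.Dual ℝ (⋀[ℝ]^j' F4)) :
    component (fun x => W x (α x)) x₀ v l x = ∑ c,
      component (fun x => W x (localLift x₀ x (Module.finBasis ℝ (ModelForm i j) c))) x₀ v l x *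
        (Module.finBasis ℝ (ModelForm i j)).coord c (localRep x₀ x (α x)) := by
  let b := Module.finBasis ℝ (ModelForm i j)
  have hα : α x = ∑ c, b.coord c (localRep x₀ x (α x)) • localLift x₀ x (b c) := by
    conv_lhs => rw [← localLift_localRep hx (α x), ← b.sum_repr (localRep x₀ x (α x))]
    simp only [map_sum, map_smul, Module.Basis.coord_apply]
  rw [component_eq_evalDual]
  conv_lhs => rw [hα]
  simp only [map_sum, map_smul, smul_eq_mul, mul_comm (b.coord _ _)]
  rfl

theorem continuousOn_localRep (x₀ : S) (φ : Module.Dual ℝ (ModelForm i j)) :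
    ContinuousOn (fun p : Form V i j × S => φ (localRep x₀ p.2 (p.1.val p.2)))
      (Set.univ ×ˢ nbhd V x₀) := by
  rintro ⟨α, x⟩ ⟨-, hx⟩
  have hxΩ : chartAt E3 x₀ x ∈ chartDomain V x₀ := ⟨x, hx, rfl⟩
  obtain ⟨K, hKx, hKΩ, hK⟩ := local_compact_nhds ((isOpen_chartDomain (V := V) x₀).mem_nhds hxΩ)
  have hsmall := uniformlySmall_localFun (Filter.tendsto_id (x := 𝓝 α)) x₀ φ 0 K hK hKΩ
  have hcont : ContinuousAt (fun z => φ (localRep x₀ z (α.val z))) x :=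
    (α.contMDiffOn_dual x₀ φ).continuousOn.continuousAt ((isOpen_nbhd x₀).mem_nhds hx)
  have hnear : ∀ᶠ z in 𝓝 x, z ∈ nbhd V x₀ ∧ chartAt E3 x₀ z ∈ K :=
    ((isOpen_nbhd x₀).eventually_mem hx).and
      (((chartAt E3 x₀).continuousAt hx.1).eventually_mem hKx)
  refine ContinuousAt.continuousWithinAt (Metric.tendsto_nhds.2 fun ε hε => ?_)
  rw [nhds_prod_eq]
  filter_upwards [(hsmall (ε / 2) (half_pos hε)).prod_mk
    (hnear.and (Metric.tendsto_nhds.1 hcont (ε / 2) (half_pos hε)))]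
    with p ⟨hpα, ⟨hpx, hpK⟩, hpc⟩
  have hform : ‖φ (localRep x₀ p.2 (p.1.val p.2)) - φ (localRep x₀ p.2 (α.val p.2))‖ < ε / 2 := by
    have h := hpα _ hpK
    rw [norm_iteratedFDerivWithin_zero, id, map_sub, Pi.sub_apply] at h
    change ‖(fun z => φ (localRep x₀ z (p.1.val z)) - φ (localRep x₀ z (α.val z)))
      ((chartAt E3 x₀).symm (chartAt E3 x₀ p.2))‖ < ε / 2 at h
    rwa [(chartAt E3 x₀).left_inv hpx.1] at h
  calc dist (φ (localRep x₀ p.2 (p.1.val p.2))) (φ (localRep x₀ x (α.val x)))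
      ≤ dist (φ (localRep x₀ p.2 (p.1.val p.2))) (φ (localRep x₀ p.2 (α.val p.2))) +
        dist (φ (localRep x₀ p.2 (α.val p.2))) (φ (localRep x₀ x (α.val x))) := dist_triangle _ _ _
    _ < ε / 2 + ε / 2 := add_lt_add (by rwa [dist_eq_norm]) hpc
    _ = ε := add_halves ε

section Fibrewise

variable [T2Space S] [ContMDiffVectorBundle ∞ F4 V (𝓡 3)] {i' j' : ℕ}
  (A : Form V i j →ₗ[ℝ] Form V i' j') (W : ∀ x : S, FibreForm V i j x →ₗ[ℝ] FibreForm V i' j' x)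
  (hA : ∀ α x, (A α).val x = W x (α.val x))

theorem exists_cutoff {x : S} {U : Set S} (hU : U ∈ 𝓝 x) :
    ∃ f : S → ℝ, ContMDiff (𝓡 3) 𝓘(ℝ) ∞ f ∧ tsupport f ⊆ U ∧ f =ᶠ[𝓝 x] 1 := by
  obtain ⟨f, -, hf⟩ := (SmoothBumpFunction.nhds_basis_tsupport (I := 𝓡 3) x).mem_iff.1 hU
  exact ⟨f, f.contMDiff, hf, f.eventuallyEq_one⟩

include A hA in
theorem contMDiffOn_component_apply_localLift (x₀ : S) (a : ModelForm i j) (v : Fin i' → E3)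
    (l : Module.Dual ℝ (⋀[ℝ]^j' F4)) :
    ContMDiffOn (𝓡 3) 𝓘(ℝ) ∞ (component (fun x => W x (localLift x₀ x a)) x₀ v l)
      (nbhd V x₀) := by
  intro x hx
  have hxn := (isOpen_nbhd (V := V) x₀).mem_nhds hx
  obtain ⟨f, hf, hs, hf₁⟩ := exists_cutoff hxn
  refine ((((A (cutoffForm x₀ f hf hs a)).smooth x₀ v l).contMDiffAt hxn).congr_of_eventuallyEq
    ?_).contMDiffWithinAt
  filter_upwards [hf₁] with y hy
  rw [component_eq_evalDual, component_eq_evalDual, hA]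
  change _ = evalDual v l (localRep x₀ y (W y (f y • localLift x₀ y a)))
  rw [hy, Pi.one_apply, one_smul]

include W hA in
/-- By a cut-off argument the coefficients of a fibrewise operator on smooth forms are smooth. -/
theorem continuous_of_fibrewise : Continuous A := by
  refine continuous_iff_continuousAt.2 fun α => tendsto_form_iff_evalDual.2 fun x₀ v l => ?_
  let b := Module.finBasis ℝ (ModelForm i j)
  have hcoeff c := contDiffOn_comp_chart_symm
    (contMDiffOn_component_apply_localLift A W hA x₀ (b c) v l)
  have hcoord c := contDiffOn_localFun (V := V) x₀ (b.coord c)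
  have hsmall := UniformlySmall.sum (isOpen_chartDomain x₀) Finset.univ
    (fun c => UniformlySmall.mul (isOpen_chartDomain x₀) (hcoeff c)
      (uniformlySmall_localFun (Filter.tendsto_id (x := 𝓝 α)) x₀ (b.coord c))
      fun β => hcoord c (β - α))
    fun c β => (hcoeff c).mul (hcoord c (β - α))
  refine hsmall.congr fun β y hy => ?_
  rw [← map_sub]
  change component (A (β - α)).val x₀ v l _ = _
  rw [funext (hA (β - α))]
  exact component_apply_eq_sum W _ (symm_mem_nbhd hy) v l

end Fibrewise

end FormTopology

section MinimalCoefficients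

variable {κ B : Type*} [Fintype κ] [AddCommGroup B] [Module ℝ B] {γ : κ → B}

/-- The Gram map `ξ ↦ ∑ k, ξ (γ k) • γ k` of a family of vectors. -/
def gramMap (γ : κ → B) : Module.Dual ℝ B →ₗ[ℝ] B :=
  ∑ k, (Module.Dual.eval ℝ B (γ k)).smulRight (γ k)

theorem gramMap_apply (ξ : Module.Dual ℝ B) : gramMap γ ξ = ∑ k, ξ (γ k) • γ k := by
  simp [gramMap]

theorem gramMap_injective (hγ : Submodule.span ℝ (Set.range γ) = ⊤) :
    Function.Injective (gramMap γ) := by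
  refine (injective_iff_map_eq_zero _).2 fun ξ hξ => LinearMap.ext_on_range hγ fun k => ?_
  have hsum : ∑ k, ξ (γ k) * ξ (γ k) = 0 := by
    simpa [gramMap_apply] using congrArg ξ hξ
  exact mul_self_eq_zero.1
    ((Finset.sum_eq_zero_iff_of_nonneg fun k _ => mul_self_nonneg _).1 hsum k (Finset.mem_univ k))

section GramMatrix

variable {ι : Type*} (b : Module.Basis ι ℝ B)

/-- The matrix of the Gram map with respect to a basis and its dual basis. -/
def gramMatrix (γ : κ → B) : Matrix ι ι ℝ :=
  Matrix.of fun s t => ∑ k, b.coord s (γ k) * b.coord t (γ k)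

variable [Fintype ι]

theorem dual_apply_eq_sum (ξ : Module.Dual ℝ B) (u : B) : ξ u = ∑ t, b.coord t u * ξ (b t) := by
  conv_lhs => rw [← b.sum_repr u]
  simp only [map_sum, map_smul, smul_eq_mul, Module.Basis.coord_apply]

theorem gramMatrix_mulVec (γ : κ → B) (ξ : Module.Dual ℝ B) :
    (gramMatrix b γ).mulVec (fun t => ξ (b t)) = fun s => b.coord s (gramMap γ ξ) := by
  funext s
  simp only [gramMatrix, Matrix.mulVec, dotProduct, Matrix.of_apply, gramMap_apply, map_sum,
    map_smul, smul_eq_mul, dual_apply_eq_sum b ξ (γ _), Finset.sum_mul]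
  rw [Finset.sum_comm]
  exact Finset.sum_congr rfl fun k _ => Finset.sum_congr rfl fun t _ => by ring

theorem det_gramMatrix_ne_zero [DecidableEq ι] (hγ : Submodule.span ℝ (Set.range γ) = ⊤) :
    (gramMatrix b γ).det ≠ 0 := by
  intro hdet
  obtain ⟨y, hy, hMy⟩ := Matrix.exists_mulVec_eq_zero_iff.2 hdet
  have hy' : y = fun t => b.constr ℝ y (b t) := funext fun t => (b.constr_basis ℝ y t).symm
  have hG : gramMap γ (b.constr ℝ y) = 0 := by
    rw [hy', gramMatrix_mulVec] at hMy
    exact b.ext_elem fun s => by simpa using congrFun hMy s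
  refine hy (hy'.trans ?_)
  rw [(injective_iff_map_eq_zero _).1 (gramMap_injective hγ) _ hG]
  rfl

end GramMatrix

variable [FiniteDimensional ℝ B]

/-- The Gram map of a spanning family as a linear equivalence. -/
def gramEquiv (hγ : Submodule.span ℝ (Set.range γ) = ⊤) : Module.Dual ℝ B ≃ₗ[ℝ] B :=
  LinearEquiv.ofInjectiveOfFinrankEq (gramMap γ) (gramMap_injective hγ) Subspace.dual_finrank_eq

/-- The coefficients of least norm which express a vector by a spanning family `γ`: they are
`ξ (γ k)`, where `ξ` is the functional which the Gram map sends to the vector. -/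
def minCoeff (hγ : Submodule.span ℝ (Set.range γ) = ⊤) (k : κ) : Module.Dual ℝ B :=
  Module.Dual.eval ℝ B (γ k) ∘ₗ (gramEquiv hγ).symm

variable (hγ : Submodule.span ℝ (Set.range γ) = ⊤)

theorem gramMap_gramEquiv_symm (θ : B) : gramMap γ ((gramEquiv hγ).symm θ) = θ :=
  (gramEquiv hγ).apply_symm_apply θ

theorem sum_minCoeff_smul (θ : B) : ∑ k, minCoeff hγ k θ • γ k = θ :=
  (gramMap_apply _).symm.trans (gramMap_gramEquiv_symm hγ θ)

end MinimalCoefficients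

section Cramer

variable {𝕜 : Type*} [NontriviallyNormedField 𝕜] {H EM : Type*}
  [TopologicalSpace H] [NormedAddCommGroup EM] [NormedSpace 𝕜 EM] {I : ModelWithCorners 𝕜 EM H}
  {r : WithTop ℕ∞} {S : Type*} [TopologicalSpace S] [ChartedSpace H S] {U : Set S}
  {ι : Type*} [Fintype ι] [DecidableEq ι] {A : S → Matrix ι ι 𝕜}

theorem contMDiffOn_det (hA : ∀ s t, ContMDiffOn I 𝓘(𝕜) r (fun x => A x s t) U) :
    ContMDiffOn I 𝓘(𝕜) r (fun x => (A x).det) U := by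
  simp only [Matrix.det_apply']
  exact contMDiffOn_finsetSum fun σ _ => contMDiffOn_const.mul
    (contMDiffOn_finsetProd fun s _ => hA _ _)

theorem contMDiffOn_of_mulVec_eq [CompleteSpace 𝕜]
    (hA : ∀ s t, ContMDiffOn I 𝓘(𝕜) r (fun x => A x s t) U)
    (hdet : ∀ x ∈ U, (A x).det ≠ 0) {y θ : S → ι → 𝕜}
    (hθ : ∀ s, ContMDiffOn I 𝓘(𝕜) r (fun x => θ x s) U)
    (hy : ∀ x ∈ U, (A x).mulVec (y x) = θ x) (s : ι) :
    ContMDiffOn I 𝓘(𝕜) r (fun x => y x s) U := by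
  have hcramer : ∀ x ∈ U, y x s = (A x).det⁻¹ * ((A x).updateCol s (θ x)).det := fun x hx => by
    rw [← Matrix.cramer_apply, ← hy x hx, Matrix.cramer_eq_adjugate_mulVec, Matrix.mulVec_mulVec,
      Matrix.adjugate_mul, Matrix.smul_mulVec, Matrix.one_mulVec, Pi.smul_apply, smul_eq_mul,
      inv_mul_cancel_left₀ (hdet x hx)]
  refine (((contMDiffOn_det hA).inv₀ hdet).mul (contMDiffOn_det fun p q => ?_)).congr hcramer
  simp only [Matrix.updateCol_apply]
  split_ifs
  exacts [hθ p, hA p q]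

end Cramer

theorem contMDiffOn_minCoeff {H EM : Type*} [TopologicalSpace H] [NormedAddCommGroup EM]
    [NormedSpace ℝ EM] {I : ModelWithCorners ℝ EM H} {r : WithTop ℕ∞} {S : Type*}
    [TopologicalSpace S] [ChartedSpace H S] {U : Set S} {B : S → Type*} [∀ x, AddCommGroup (B x)]
    [∀ x, Module ℝ (B x)] [∀ x, FiniteDimensional ℝ (B x)] {κ ι : Type*} [Fintype κ] [Finite ι]
    {γ : κ → ∀ x, B x} {θ : ∀ x, B x} {d : ι → ∀ x, B x} {φ : ι → ∀ x, Module.Dual ℝ (B x)}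
    (hγ : ∀ x, Submodule.span ℝ (Set.range fun k => γ k x) = ⊤)
    (hd : ∀ x ∈ U, ∃ b : Module.Basis ι ℝ (B x), ∀ s, b s = d s x ∧ b.coord s = φ s x)
    (hγφ : ∀ k s, ContMDiffOn I 𝓘(ℝ) r (fun x => φ s x (γ k x)) U)
    (hθφ : ∀ s, ContMDiffOn I 𝓘(ℝ) r (fun x => φ s x (θ x)) U) (k : κ) :
    ContMDiffOn I 𝓘(ℝ) r (fun x => minCoeff (hγ x) k (θ x)) U := by
  classical
  have := Fintype.ofFinite ι
  let ξ (x : S) : Module.Dual ℝ (B x) := (gramEquiv (hγ x)).symm (θ x)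
  let A (x : S) : Matrix ι ι ℝ := Matrix.of fun s t => ∑ k, φ s x (γ k x) * φ t x (γ k x)
  have hξ : ∀ s, ContMDiffOn I 𝓘(ℝ) r (fun x => ξ x (d s x)) U := by
    refine contMDiffOn_of_mulVec_eq (A := A)
      (fun s t => contMDiffOn_finsetSum fun k _ => (hγφ k s).mul (hγφ k t))
      (fun x hx => ?_) hθφ fun x hx => ?_ <;> obtain ⟨b, hb⟩ := hd x hx
    · simpa only [gramMatrix, hb] using det_gramMatrix_ne_zero b (hγ x)
    · have h := gramMatrix_mulVec b (fun k => γ k x) (ξ x)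
      rw [gramMap_gramEquiv_symm] at h
      simpa only [gramMatrix, hb] using h
  refine (contMDiffOn_finsetSum (t := Finset.univ) fun s _ => (hγφ k s).mul (hξ s)).congr
    fun x hx => ?_
  obtain ⟨b, hb⟩ := hd x hx
  have h := dual_apply_eq_sum b (ξ x) (γ k x)
  simp only [hb] at h
  exact h

section RightInverse

variable {S : Type*} [TopologicalSpace S] [ChartedSpace E3 S] [IsManifold (𝓡 3) ∞ S]
  {V : S → Type*} [TopologicalSpace (TotalSpace F4 V)] [∀ x, AddCommGroup (V x)]
  [∀ x, Module ℝ (V x)] [∀ x, TopologicalSpace (V x)] [FiberBundle F4 V] [VectorBundle ℝ F4 V]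
  {i j : ℕ}

/-- The basis of the fibre at `x` defined by the chart and the trivialization at `x₀`. -/
def localBasis {x₀ x : S} (hx : x ∈ nbhd V x₀) :
    Module.Basis (Fin (Module.finrank ℝ (ModelForm i j))) ℝ (FibreForm V i j x) :=
  (Module.finBasis ℝ (ModelForm i j)).map
    { localLift x₀ x with
      invFun := localRep x₀ x
      left_inv := localRep_localLift hx
      right_inv := localLift_localRep hx }

instance (x : S) : FiniteDimensional ℝ (FibreForm V i j x) :=
  (localBasis (mem_nbhd_self x)).finiteDimensional_of_finite

theorem val_sum_apply {κ : Type*} (s : Finset κ) (α : κ → Form V i j) (x : S) :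
    (∑ k ∈ s, α k).val x = ∑ k ∈ s, (α k).val x :=
  map_sum (⟨⟨fun α => α.val x, rfl⟩, fun _ _ => rfl⟩ : Form V i j →+ FibreForm V i j x) α s

section Coefficients

variable {κ : Type*} [Fintype κ] {γ : κ → Form V i j}
  (hγ : ∀ x, Submodule.span ℝ (Set.range fun k => (γ k).val x) = ⊤) (Θ : Form V i j)

theorem contMDiff_minCoeff_val (k : κ) :
    ContMDiff (𝓡 3) 𝓘(ℝ) ∞ fun x => minCoeff (B := FibreForm V i j x) (hγ x) k (Θ.val x) := by
  intro x₀
  let φ := (Module.finBasis ℝ (ModelForm i j)).coord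
  have h := contMDiffOn_minCoeff (B := FibreForm V i j) (θ := Θ.val)
    (φ := fun s x => φ s ∘ₗ localRep x₀ x)
    (d := fun s x => localLift x₀ x (Module.finBasis ℝ (ModelForm i j) s)) hγ
    (fun x (hx : x ∈ nbhd V x₀) => ⟨localBasis hx, fun _ => ⟨rfl, rfl⟩⟩)
    (fun k s => (γ k).contMDiffOn_dual x₀ (φ s)) (fun s => Θ.contMDiffOn_dual x₀ (φ s)) k
  exact h.contMDiffAt ((isOpen_nbhd x₀).mem_nhds (mem_nbhd_self x₀))

end Coefficients

variable [T2Space S] [ContMDiffVectorBundle ∞ F4 V (𝓡 3)]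

theorem exists_form_val_eq (x : S) (a : FibreForm V i j x) : ∃ α : Form V i j, α.val x = a := by
  obtain ⟨f, hf, hs, hf₁⟩ := exists_cutoff ((isOpen_nbhd (V := V) x).mem_nhds (mem_nbhd_self x))
  refine ⟨cutoffForm x f hf hs (localRep x x a), ?_⟩
  change f x • localLift x x (localRep x x a) = a
  rw [localLift_localRep (mem_nbhd_self x), hf₁.eq_of_nhds, Pi.one_apply, one_smul]

variable (V i j) in
theorem exists_finite_spanning_forms [CompactSpace S] : ∃ s : Set (Form V i j), s.Finite ∧
    ∀ x, Submodule.span ℝ (Set.range fun β : s => β.1.val x) = ⊤ := by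
  choose f hf hs hf₁ using fun x : S =>
    exists_cutoff ((isOpen_nbhd (V := V) x).mem_nhds (mem_nbhd_self x))
  obtain ⟨t, ht⟩ := isCompact_univ.elim_finite_subcover (fun x₀ => {x | f x₀ x ≠ 0})
    (fun x₀ => isOpen_ne_fun (hf x₀).continuous continuous_const) fun x _ =>
      Set.mem_iUnion.2 ⟨x, by simp [(hf₁ x).eq_of_nhds]⟩
  let b := Module.finBasis ℝ (ModelForm i j)
  let β (x₀ : S) (c : Fin _) : Form V i j := cutoffForm x₀ (f x₀) (hf x₀) (hs x₀) (b c)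
  refine ⟨⋃ x₀ ∈ t, Set.range (β x₀), t.finite_toSet.biUnion fun _ _ => Set.finite_range _,
    fun x => ?_⟩
  obtain ⟨x₀, hx₀, hx⟩ : ∃ x₀ ∈ t, f x₀ x ≠ 0 := by simpa using ht (Set.mem_univ x)
  rw [eq_top_iff, ← (localBasis (hs x₀ (subset_tsupport _ hx))).span_eq, Submodule.span_le]
  rintro _ ⟨c, rfl⟩
  have hc : localLift x₀ x (b c) = (f x₀ x)⁻¹ • (β x₀ c).val x := (inv_smul_smul₀ hx _).symm
  change localLift x₀ x (b c) ∈ Submodule.span ℝ _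
  rw [hc]
  exact Submodule.smul_mem _ _
    (Submodule.subset_span ⟨⟨β x₀ c, Set.mem_biUnion hx₀ ⟨c, rfl⟩⟩, rfl⟩)

/-- Pushing finitely many spanning forms forward yields a spanning family of each target fibre, and
the coefficients of least norm with respect to it depend smoothly on the point. -/
theorem exists_continuous_rightInverse [CompactSpace S] {i' j' : ℕ}
    (A : Form V i j →ₗ[ℝ] Form V i' j') (W : ∀ x : S, FibreForm V i j x →ₗ[ℝ] FibreForm V i' j' x)
    (hA : ∀ α x, (A α).val x = W x (α.val x)) (hW : ∀ x, Function.Surjective (W x)) :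
    ∃ R : Form V i' j' →ₗ[ℝ] Form V i j, Continuous R ∧ ∀ Θ, A (R Θ) = Θ := by
  obtain ⟨s, hs, hspan⟩ := exists_finite_spanning_forms V i j
  have := hs.fintype
  have hγ : ∀ x, Submodule.span ℝ (Set.range fun β : s => (A β.1).val x) = ⊤ := fun x => by
    simp only [hA]
    rw [show (fun β : s => W x (β.1.val x)) = W x ∘ fun β : s => β.1.val x from rfl,
      Set.range_comp, ← Submodule.map_span, hspan x, Submodule.map_top,
      LinearMap.range_eq_top.2 (hW x)]
  let c (β : s) (Θ : Form V i' j') (x : S) : ℝ := minCoeff (hγ x) β (Θ.val x)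
  let RΘ (Θ : Form V i' j') : Form V i j :=
    ∑ β : s, functionSmul (c β Θ) (contMDiff_minCoeff_val hγ Θ β) β.1
  have hval : ∀ Θ x, (RΘ Θ).val x = ∑ β : s, c β Θ x • β.1.val x := fun Θ x => val_sum_apply _ _ x
  let R : Form V i' j' →ₗ[ℝ] Form V i j :=
    { toFun := RΘ
      map_add' := fun Θ Θ' => Form.ext (funext fun x => by
        simp only [val_add, Pi.add_apply, hval, c, map_add, add_smul, Finset.sum_add_distrib])
      map_smul' := fun r Θ => Form.ext (funext fun x => by
        simp only [val_smul, Pi.smul_apply, hval, c, map_smul, smul_assoc, Finset.smul_sum,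
          RingHom.id_apply]) }
  refine ⟨R, continuous_of_fibrewise R
    (fun x => ∑ β : s, LinearMap.smulRight (M₁ := FibreForm V i' j' x) (M := FibreForm V i j x)
      (minCoeff (B := FibreForm V i' j' x) (hγ x) β) (β.1.val x)) fun Θ x => ?_, fun Θ => ?_⟩
  · simp [R, hval, c]
  · refine Form.ext (funext fun x => ?_)
    rw [hA]
    change W x ((RΘ Θ).val x) = _
    simp only [hval, map_sum, map_smul, ← hA]
    exact sum_minCoeff_smul (hγ x) (Θ.val x)

end RightInverse

section Density

variable {S : Type*} [TopologicalSpace S] [ChartedSpace E3 S]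

theorem finrank_tangentSpace (x : S) : Module.finrank ℝ (TangentSpace (𝓡 3) x) = 3 :=
  finrank_euclideanSpace_fin

instance finiteDimensional_tangentSpace (x : S) : FiniteDimensional ℝ (TangentSpace (𝓡 3) x) :=
  Module.finite_of_finrank_eq_succ (finrank_tangentSpace x)

section VolumeForm

variable {V : S → Type*} [TopologicalSpace (TotalSpace F4 V)] [∀ x, AddCommGroup (V x)]
  [∀ x, Module ℝ (V x)] [∀ x, TopologicalSpace (V x)] [FiberBundle F4 V] [VectorBundle ℝ F4 V]

theorem finrank_fibre (L : LorentzStructure V) (x : S) : Module.finrank ℝ (V x) = 4 := by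
  obtain ⟨f, -⟩ := L.exists_frame x
  rw [Module.finrank_eq_card_basis f, Fintype.card_fin]

theorem contMDiffOn_vol_map (L : LorentzStructure V) (x₀ : S) (u : ⋀[ℝ]^4 F4) :
    ContMDiffOn (𝓡 3) 𝓘(ℝ) ∞ (fun x => exteriorPower.alternatingMapLinearEquiv (L.vol x)
      (exteriorPower.map 4 ((trivializationAt F4 V x₀).symmₗ ℝ x) u))
      (trivializationAt F4 V x₀).baseSet := by
  refine contMDiffOn_dual_of_span_eq_top (exteriorPower.ιMulti_span ℝ 4 F4)
    (G := fun x => exteriorPower.alternatingMapLinearEquiv (L.vol x) ∘ₗ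
      exteriorPower.map 4 ((trivializationAt F4 V x₀).symmₗ ℝ x)) ?_ u
  rintro _ ⟨w, rfl⟩
  simp only [LinearMap.comp_apply, exteriorPower.map_apply_ιMulti,
    exteriorPower.alternatingMapLinearEquiv_apply_ιMulti]
  exact L.vol_smooth x₀ w

end VolumeForm

variable [IsManifold (𝓡 3) ∞ S]

/-- The coordinate frame `coordFrame x₀ x` as a basis of the tangent space. -/
def coordBasis {x₀ x : S} (hx : x ∈ (chartAt E3 x₀).source) :
    Module.Basis (Fin 3) ℝ (TangentSpace (𝓡 3) x) :=
  (EuclideanSpace.basisFun (Fin 3) ℝ).toBasis.map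
    ((trivializationAt E3 (TangentSpace (𝓡 3) : S → Type _) x₀).linearEquivAt ℝ x
      (mem_tangent_baseSet hx)).symm

theorem coe_coordBasis {x₀ x : S} (hx : x ∈ (chartAt E3 x₀).source) :
    ⇑(coordBasis hx) = coordFrame x₀ x := by
  funext n
  rw [coordBasis, Module.Basis.map_apply, coordFrame, coordVec,
    Trivialization.symmₗ_apply _ (mem_tangent_baseSet hx), OrthonormalBasis.coe_toBasis,
    Trivialization.linearEquivAt_symm_apply]

theorem coordSign_mul_det {o : ∀ x : S, Orientation ℝ (TangentSpace (𝓡 3) x) (Fin 3)} {x₀ x : S}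
    (hx : x ∈ (chartAt E3 x₀).source) {g : Module.Basis (Fin 3) ℝ (TangentSpace (𝓡 3) x)}
    (hg : g.orientation = o x) :
    coordSign o x₀ x * g.det (coordFrame x₀ x) = |g.det (coordFrame x₀ x)| := by
  rw [← coe_coordBasis hx]
  have hpos : (∃ f : Module.Basis (Fin 3) ℝ (TangentSpace (𝓡 3) x),
      (∀ n, f n = coordFrame x₀ x n) ∧ f.orientation = o x) ↔ 0 < g.det (coordBasis hx) := by
    rw [← g.orientation_eq_iff_det_pos, hg, ← coe_coordBasis hx]
    constructor
    · rintro ⟨f, hf, hfo⟩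
      rw [← hfo, Module.Basis.eq_of_apply_eq hf]
    · exact fun h => ⟨_, fun _ => rfl, h.symm⟩
  rw [coordSign]
  split_ifs with h
  · rw [one_mul, abs_of_pos (hpos.1 h)]
  · rw [neg_one_mul, abs_of_nonpos (not_lt.1 (mt hpos.2 h))]

theorem coordSign_ne_zero (o : ∀ x : S, Orientation ℝ (TangentSpace (𝓡 3) x) (Fin 3)) (x₀ x : S) :
    coordSign o x₀ x ≠ 0 := by
  rw [coordSign]
  split_ifs
  · exact one_ne_zero
  · exact neg_ne_zero.2 one_ne_zero

variable {V : S → Type*} [TopologicalSpace (TotalSpace F4 V)] [∀ x, AddCommGroup (V x)]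
  [∀ x, Module ℝ (V x)] [∀ x, TopologicalSpace (V x)] [FiberBundle F4 V] [VectorBundle ℝ F4 V]

/-- The isomorphism of `Λ^3 T_x^*S ⊗ ⋀^4 V_x` with `Λ^3 T_x^*S` which the volume form induces. -/
def scalarForm (L : LorentzStructure V) (x : S) :
    FibreForm V 3 4 x →ₗ[ℝ] ((TangentSpace (𝓡 3) x) [⋀^Fin 3]→ₗ[ℝ] ℝ) where
  toFun ξ := (exteriorPower.alternatingMapLinearEquiv (L.vol x)).compAlternatingMap ξ
  map_add' ξ ξ' := AlternatingMap.ext fun v => by simp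
  map_smul' c ξ := AlternatingMap.ext fun v => by simp

theorem density_eq (o : ManifoldOrientation S) (L : LorentzStructure V) (η : Form V 3 4)
    (x₀ x : S) :
    density o L η x₀ x = coordSign o.orient x₀ x * scalarForm L x (η.val x) (coordFrame x₀ x) :=
  rfl

theorem density_add (o : ManifoldOrientation S) (L : LorentzStructure V) (η η' : Form V 3 4)
    (x₀ x : S) : density o L (η + η') x₀ x = density o L η x₀ x + density o L η' x₀ x := by
  simp only [density_eq, val_add, Pi.add_apply, map_add, AlternatingMap.add_apply, mul_add]

theorem density_of_val_eq_smul (o : ManifoldOrientation S) (L : LorentzStructure V)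
    {η η' : Form V 3 4} {x : S} {c : ℝ} (h : η'.val x = c • η.val x) (x₀ : S) :
    density o L η' x₀ x = c * density o L η x₀ x := by
  rw [density_eq, h, map_smul, AlternatingMap.smul_apply, smul_eq_mul, density_eq,
    mul_left_comm]

theorem density_eq_abs_det (o : ManifoldOrientation S) (L : LorentzStructure V) (η : Form V 3 4)
    {x₀ x : S} (hx : x ∈ (chartAt E3 x₀).source)
    {g : Module.Basis (Fin 3) ℝ (TangentSpace (𝓡 3) x)} (hg : g.orientation = o.orient x) :
    density o L η x₀ x = |g.det (coordFrame x₀ x)| * scalarForm L x (η.val x) g := by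
  rw [density_eq, AlternatingMap.eq_smul_basis_det g (scalarForm L x (η.val x)),
    AlternatingMap.smul_apply, AlternatingMap.smul_apply, g.det_self, ← coordSign_mul_det hx hg]
  simp only [smul_eq_mul]
  ring

theorem density_pos_iff (o : ManifoldOrientation S) (L : LorentzStructure V) (η : Form V 3 4)
    {x₀ x₁ x : S} (h₀ : x ∈ (chartAt E3 x₀).source) (h₁ : x ∈ (chartAt E3 x₁).source) :
    0 < density o L η x₀ x ↔ 0 < density o L η x₁ x := by
  have hcard : Fintype.card (Fin 3) = Module.finrank ℝ (TangentSpace (𝓡 3) x) :=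
    (finrank_tangentSpace x).symm
  have hg := (o.orient x).someBasis_orientation hcard
  have hdet : ∀ {z : S}, x ∈ (chartAt E3 z).source →
      0 < |((o.orient x).someBasis hcard).det (coordFrame z x)| := fun hz =>
    abs_pos.2 (coe_coordBasis hz ▸ (Module.Basis.isUnit_det _ (coordBasis hz)).ne_zero)
  rw [density_eq_abs_det o L η h₀ hg, density_eq_abs_det o L η h₁ hg,
    mul_pos_iff_of_pos_left (hdet h₀), mul_pos_iff_of_pos_left (hdet h₁)]

theorem contMDiffOn_scalarForm_localLift (L : LorentzStructure V) (x₀ y : S) (a : ModelForm 3 4) :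
    ContMDiffOn (𝓡 3) 𝓘(ℝ) ∞ (fun x => scalarForm L x (localLift y x a) (coordFrame x₀ x))
      ((chartAt E3 x₀).source ∩ nbhd V y) :=
  contMDiffOn_dual_multilinearMap
    (G := fun x => exteriorPower.alternatingMapLinearEquiv (L.vol x) ∘ₗ
      exteriorPower.map 4 ((trivializationAt F4 V y).symmₗ ℝ x))
    (fun u => (contMDiffOn_vol_map L y u).mono fun _ hx => hx.2.2)
    a.toMultilinearMap fun k =>
      (contMDiffOn_transition (TangentSpace (𝓡 3) : S → Type _) x₀ y
        (EuclideanSpace.basisFun (Fin 3) ℝ k)).mono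
        fun _ hx => ⟨mem_tangent_baseSet hx.1, mem_tangent_baseSet hx.2.1⟩

theorem scalarForm_apply_eq_sum (L : LorentzStructure V) {y x : S} (hx : x ∈ nbhd V y)
    (ξ : FibreForm V 3 4 x) (t : Fin 3 → TangentSpace (𝓡 3) x) :
    scalarForm L x ξ t = ∑ c, (Module.finBasis ℝ (ModelForm 3 4)).coord c (localRep y x ξ) *
      scalarForm L x (localLift y x (Module.finBasis ℝ (ModelForm 3 4) c)) t := by
  let φ : Module.Dual ℝ (ModelForm 3 4) := exteriorPower.alternatingMapLinearEquiv (L.vol x) ∘ₗ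
    { toFun := fun a => localLift y x a t
      map_add' := fun a a' => by rw [map_add, AlternatingMap.add_apply]
      map_smul' := fun c a => by rw [map_smul, AlternatingMap.smul_apply, RingHom.id_apply] }
  have h := dual_apply_eq_sum (Module.finBasis ℝ (ModelForm 3 4)) φ (localRep y x ξ)
  rwa [show φ (localRep y x ξ) = scalarForm L x (localLift y x (localRep y x ξ)) t from rfl,
    localLift_localRep hx] at h

variable {X Y : Type*} [TopologicalSpace X] [TopologicalSpace Y] {i j k l : ℕ}

/-- A family of forms whose local representatives depend jointly continuously on the parameter and
the point. This is what makes the integral depend continuously on the parameter. -/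
def JointlyContinuous (H : X → Form V i j) : Prop :=
  ∀ (y : S) (φ : Module.Dual ℝ (ModelForm i j)),
    ContinuousOn (fun p : X × S => φ (localRep y p.2 ((H p.1).val p.2))) (Set.univ ×ˢ nbhd V y)

theorem jointlyContinuous_id : JointlyContinuous (id : Form V i j → Form V i j) :=
  fun y φ => continuousOn_localRep y φ

theorem JointlyContinuous.comp {H : X → Form V i j} (hH : JointlyContinuous H) {g : Y → X}
    (hg : Continuous g) : JointlyContinuous (H ∘ g) := fun y φ =>
  (hH y φ).comp (f := fun p : Y × S => (g p.1, p.2)) (by fun_prop) fun p hp => ⟨trivial, hp.2⟩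

theorem JointlyContinuous.wedge {H : X → Form V i j} {G : X → Form V k l}
    (hH : JointlyContinuous H) (hG : JointlyContinuous G) :
    JointlyContinuous fun p => wedge (H p) (G p) := by
  intro y φ
  have hφ : φ ∈ Submodule.span ℝ (Set.range _) := span_range_evalDual _ _ ▸ Submodule.mem_top
  induction hφ using Submodule.span_induction with
  | mem φ hφ =>
    obtain ⟨⟨v, m⟩, rfl⟩ := hφ
    have hcomp : ∀ p : X × S,
        evalDual v m (localRep y p.2 ((LPC.wedge (H p.1) (G p.1)).val p.2)) = _ :=
      fun p => congrFun (component_wedge (H p.1).val (G p.1).val y v m) p.2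
    simp only [hcomp, component_eq_evalDual]
    refine continuousOn_const.mul (continuousOn_finsetSum _ fun q _ => continuousOn_const.mul
      (continuousOn_finsetSum _ fun a _ => continuousOn_finsetSum _ fun b _ => ?_))
    exact ((hH y _).mul (hG y _)).mul continuousOn_const
  | zero => exact continuousOn_const
  | add φ ψ _ _ hφ hψ => exact hφ.add hψ
  | smul c φ _ hφ => exact continuousOn_const.mul hφ

theorem JointlyContinuous.continuousOn_density {H : X → Form V 3 4} (hH : JointlyContinuous H)
    (o : ManifoldOrientation S) (L : LorentzStructure V) (x₀ : S) :
    ContinuousOn (fun p : X × S => density o L (H p.1) x₀ p.2)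
      (Set.univ ×ˢ (chartAt E3 x₀).source) := by
  simp only [density_eq]
  refine ContinuousOn.mul ((o.locallyConstant x₀).comp continuousOn_snd fun p hp => hp.2) ?_
  rintro ⟨a, y⟩ ⟨-, hy⟩
  have hU : IsOpen (Set.univ ×ˢ ((chartAt E3 x₀).source ∩ nbhd V y) : Set (X × S)) :=
    isOpen_univ.prod ((chartAt E3 x₀).open_source.inter (isOpen_nbhd y))
  refine (ContinuousOn.continuousAt ?_
    (hU.mem_nhds ⟨trivial, hy, mem_nbhd_self y⟩)).continuousWithinAt
  refine ContinuousOn.congr (continuousOn_finsetSum _ fun c _ => ContinuousOn.mul ?_ ?_)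
    fun p hp => scalarForm_apply_eq_sum L hp.2.2 _ _
  · exact (hH y _).mono (Set.prod_mono le_rfl Set.inter_subset_right)
  · exact (contMDiffOn_scalarForm_localLift L x₀ y _).continuousOn.comp continuousOn_snd
      fun p hp => hp.2

end Density

section Integral

variable {S : Type*} [TopologicalSpace S] [ChartedSpace E3 S] [IsManifold (𝓡 3) ∞ S]
  [T2Space S] [CompactSpace S]

variable (S) in
theorem finite_chartPartition_ne_zero : {x₀ : S | (chartPartition S x₀ : S → ℝ) ≠ 0}.Finite :=
  (chartPartition S).locallyFinite.finite_nonempty_of_compact.subset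
    fun _ hx₀ => Function.support_nonempty_iff.2 hx₀

variable (S) in
/-- The finitely many charts which contribute to the integral. -/
def activeCharts : Finset S := (finite_chartPartition_ne_zero S).toFinset

variable (S) in
/-- The coordinate image of the support of a function of the partition of unity. -/
def chartSupport (x₀ : S) : Set E3 := chartAt E3 x₀ '' tsupport (chartPartition S x₀)

theorem isCompact_chartSupport (x₀ : S) : IsCompact (chartSupport S x₀) :=
  (isClosed_tsupport _).isCompact.image_of_continuousOn
    ((chartAt E3 x₀).continuousOn.mono (chartPartition_isSubordinate x₀))

theorem chartSupport_subset_target (x₀ : S) : chartSupport S x₀ ⊆ (chartAt E3 x₀).target := by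
  rintro _ ⟨x, hx, rfl⟩
  exact (chartAt E3 x₀).map_source (chartPartition_isSubordinate x₀ hx)

theorem integrableOn_chartSupport (x₀ : S) (g : C(S, ℝ)) :
    IntegrableOn (fun y => g ((chartAt E3 x₀).symm y)) (chartSupport S x₀) :=
  (g.continuous.comp_continuousOn ((chartAt E3 x₀).continuousOn_symm.mono
    (chartSupport_subset_target x₀))).integrableOn_compact (isCompact_chartSupport x₀)

/-- Integration over `chartSupport S x₀` in the chart at `x₀`, as a continuous functional. -/
def chartIntegral (x₀ : S) : C(S, ℝ) →L[ℝ] ℝ :=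
  LinearMap.mkContinuous
    { toFun := fun g => ∫ y in chartSupport S x₀, g ((chartAt E3 x₀).symm y)
      map_add' := fun g h => integral_add (integrableOn_chartSupport x₀ g)
        (integrableOn_chartSupport x₀ h)
      map_smul' := fun c g => integral_const_mul c _ }
    (volume.real (chartSupport S x₀)) fun g => by
      rw [mul_comm]
      exact norm_setIntegral_le_of_norm_le_const (isCompact_chartSupport x₀).measure_lt_top
        fun y _ => g.norm_coe_le_norm _

theorem chartIntegral_nonneg {x₀ : S} {g : C(S, ℝ)} (hg : ∀ x, 0 ≤ g x) :
    0 ≤ chartIntegral x₀ g :=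
  setIntegral_nonneg (isCompact_chartSupport x₀).measurableSet fun _ _ => hg _

theorem chartIntegral_pos {x₀ x : S} {g : C(S, ℝ)} (hg : ∀ x, 0 ≤ g x)
    (hs : Function.support g ⊆ tsupport (chartPartition S x₀)) (hx : 0 < g x) :
    0 < chartIntegral x₀ g := by
  let U := (chartAt E3 x₀).target ∩ (fun y => g ((chartAt E3 x₀).symm y)) ⁻¹' {0}ᶜ
  have hU : IsOpen U := (g.continuous.comp_continuousOn
    (chartAt E3 x₀).continuousOn_symm).isOpen_inter_preimage (chartAt E3 x₀).open_target
      isOpen_compl_singleton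
  have hxs : x ∈ (chartAt E3 x₀).source := chartPartition_isSubordinate x₀ (hs hx.ne')
  have hxU : chartAt E3 x₀ x ∈ U := by
    refine ⟨(chartAt E3 x₀).map_source hxs, ?_⟩
    rw [Set.mem_preimage, (chartAt E3 x₀).left_inv hxs]
    exact hx.ne'
  change 0 < ∫ y in chartSupport S x₀, g ((chartAt E3 x₀).symm y)
  rw [setIntegral_pos_iff_support_of_nonneg_ae (Filter.Eventually.of_forall fun y => hg _)
    (integrableOn_chartSupport x₀ g)]
  exact (hU.measure_pos volume ⟨_, hxU⟩).trans_le (measure_mono fun y hy =>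
    ⟨hy.2, _, hs hy.2, (chartAt E3 x₀).right_inv hy.1⟩)

variable {V : S → Type*} [TopologicalSpace (TotalSpace F4 V)] [∀ x, AddCommGroup (V x)]
  [∀ x, Module ℝ (V x)] [∀ x, TopologicalSpace (V x)] [FiberBundle F4 V] [VectorBundle ℝ F4 V]

theorem JointlyContinuous.continuous_chartPartition_mul_density {X : Type*} [TopologicalSpace X]
    {H : X → Form V 3 4} (hH : JointlyContinuous H) (o : ManifoldOrientation S)
    (L : LorentzStructure V) (x₀ : S) :
    Continuous fun p : X × S => chartPartition S x₀ p.2 * density o L (H p.1) x₀ p.2 := by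
  refine continuous_iff_continuousAt.2 fun ⟨a, x⟩ => ?_
  by_cases hx : x ∈ tsupport (chartPartition S x₀)
  · have hdensity : ContinuousAt (fun p : X × S => density o L (H p.1) x₀ p.2) (a, x) :=
      (hH.continuousOn_density o L x₀).continuousAt
        ((isOpen_univ.prod (chartAt E3 x₀).open_source).mem_nhds
          ⟨trivial, chartPartition_isSubordinate x₀ hx⟩)
    exact ((chartPartition S x₀).contMDiff.continuous.comp continuous_snd).continuousAt.mul
      hdensity
  · refine (continuousAt_const (y := (0 : ℝ))).congr ?_
    filter_upwards [continuousAt_snd.eventually (notMem_tsupport_iff_eventuallyEq.1 hx)] with p hp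
    rw [hp, Pi.zero_apply, zero_mul]

variable (o : ManifoldOrientation S) (L : LorentzStructure V)

/-- The density of a form in the chart at `x₀`, multiplied by the function of the partition of unity
which belongs to this chart. -/
def weightedDensity (x₀ : S) (η : Form V 3 4) : C(S, ℝ) where
  toFun x := chartPartition S x₀ x * density o L η x₀ x
  continuous_toFun := (jointlyContinuous_id.continuous_chartPartition_mul_density o L x₀).comp
    (Continuous.prodMk_right η)

theorem chartIntegral_weightedDensity (x₀ : S) (η : Form V 3 4) :
    chartIntegral x₀ (weightedDensity o L x₀ η) =
      ∫ y in (chartAt E3 x₀).target, chartPartition S x₀ ((chartAt E3 x₀).symm y) *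
        density o L η x₀ ((chartAt E3 x₀).symm y) := by
  refine (setIntegral_eq_of_subset_of_forall_sdiff_eq_zero
    (chartAt E3 x₀).open_target.measurableSet (chartSupport_subset_target x₀) fun y hy => ?_).symm
  have hy₀ : (chartAt E3 x₀).symm y ∉ tsupport (chartPartition S x₀) := fun hs =>
    hy.2 ⟨_, hs, (chartAt E3 x₀).right_inv hy.1⟩
  exact mul_eq_zero_of_left (image_eq_zero_of_notMem_tsupport hy₀) _

theorem formIntegral_eq_sum (η : Form V 3 4) :
    formIntegral o L η = ∑ x₀ ∈ activeCharts S, chartIntegral x₀ (weightedDensity o L x₀ η) := by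
  simp only [chartIntegral_weightedDensity]
  refine finsum_eq_sum_of_support_subset _ fun x₀ hx₀ => ?_
  rw [activeCharts, Set.Finite.coe_toFinset]
  refine fun h₀ => hx₀ ?_
  simp only [h₀, Pi.zero_apply, zero_mul, integral_zero]

theorem formIntegral_add (η η' : Form V 3 4) :
    formIntegral o L (η + η') = formIntegral o L η + formIntegral o L η' := by
  simp only [formIntegral_eq_sum, ← Finset.sum_add_distrib, ← map_add]
  refine Finset.sum_congr rfl fun x₀ _ => congrArg _ (ContinuousMap.ext fun x => ?_)
  change _ * density o L (η + η') x₀ x = _ * _ + _ * _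
  rw [density_add, mul_add]

theorem formIntegral_smul (c : ℝ) (η : Form V 3 4) :
    formIntegral o L (c • η) = c * formIntegral o L η := by
  simp only [formIntegral_eq_sum, Finset.mul_sum]
  simp only [← smul_eq_mul, ← map_smul]
  refine Finset.sum_congr rfl fun x₀ _ => congrArg _ (ContinuousMap.ext fun x => ?_)
  change _ * density o L (c • η) x₀ x = c * (_ * _)
  rw [density_of_val_eq_smul o L (c := c) (η := η) rfl, mul_left_comm]

theorem JointlyContinuous.continuous_formIntegral {X : Type*} [TopologicalSpace X]
    {H : X → Form V 3 4} (hH : JointlyContinuous H) :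
    Continuous fun a => formIntegral o L (H a) := by
  simp only [formIntegral_eq_sum]
  exact continuous_finsetSum _ fun x₀ _ => (chartIntegral x₀).continuous.comp
    (ContinuousMap.curry ⟨_, hH.continuous_chartPartition_mul_density o L x₀⟩).continuous

theorem support_weightedDensity_subset (x₀ : S) (η : Form V 3 4) :
    Function.support (weightedDensity o L x₀ η) ⊆ Function.support (chartPartition S x₀) :=
  fun _ hx => left_ne_zero_of_mul hx

variable {η : Form V 3 4}

theorem weightedDensity_nonneg
    (hη : ∀ x₀ x, x ∈ (chartAt E3 x₀).source → 0 ≤ density o L η x₀ x) (x₀ x : S) :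
    0 ≤ weightedDensity o L x₀ η x := by
  by_cases hx : weightedDensity o L x₀ η x = 0
  · exact hx.ge
  · have hxs := subset_tsupport _ (support_weightedDensity_subset o L x₀ η hx)
    exact mul_nonneg ((chartPartition S).nonneg x₀ x)
      (hη x₀ x (chartPartition_isSubordinate x₀ hxs))

theorem formIntegral_pos (hη : ∀ x₀ x, x ∈ (chartAt E3 x₀).source → 0 ≤ density o L η x₀ x)
    {x : S} (hx : 0 < density o L η x x) : 0 < formIntegral o L η := by
  obtain ⟨x₀, hx₀⟩ := (chartPartition S).exists_pos_of_mem (Set.mem_univ x)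
  have hxs : x ∈ (chartAt E3 x₀).source :=
    chartPartition_isSubordinate x₀ (subset_tsupport _ hx₀.ne')
  have hactive : x₀ ∈ activeCharts S := by
    rw [activeCharts, Set.Finite.mem_toFinset]
    exact fun h₀ => hx₀.ne' (congrFun h₀ x)
  have hpos : 0 < weightedDensity o L x₀ η x :=
    mul_pos hx₀ ((density_pos_iff o L η hxs (mem_chart_source E3 x)).2 hx)
  have hnonneg := weightedDensity_nonneg o L hη
  rw [formIntegral_eq_sum]
  exact Finset.sum_pos' (fun z _ => chartIntegral_nonneg (hnonneg z)) ⟨x₀, hactive,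
    chartIntegral_pos (hnonneg x₀)
      ((support_weightedDensity_subset o L x₀ η).trans (subset_tsupport _)) hpos⟩

theorem exists_formIntegral_functionSmul_pos {x : S} (hx : 0 < density o L η x x) :
    ∃ (f : S → ℝ) (hf : ContMDiff (𝓡 3) 𝓘(ℝ) ∞ f),
      0 < formIntegral o L (functionSmul f hf η) := by
  have hcont : ContinuousOn (fun z => density o L η x z) (chartAt E3 x).source :=
    (jointlyContinuous_id.continuousOn_density o L x).comp (f := fun z => (η, z)) (by fun_prop)
      fun z hz => ⟨trivial, hz⟩
  have hU : (chartAt E3 x).source ∩ (fun z => density o L η x z) ⁻¹' Set.Ioi 0 ∈ 𝓝 x :=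
    (hcont.isOpen_inter_preimage (chartAt E3 x).open_source isOpen_Ioi).mem_nhds
      ⟨mem_chart_source E3 x, hx⟩
  obtain ⟨f, hfU, -⟩ := (SmoothBumpFunction.nhds_basis_support (I := 𝓡 3) hU).mem_iff.1 hU
  have hdensity x₀ z : density o L (functionSmul f f.contMDiff η) x₀ z = f z * density o L η x₀ z :=
    density_of_val_eq_smul o L rfl x₀
  refine ⟨f, f.contMDiff, formIntegral_pos o L (fun x₀ z hz => ?_) (x := x) ?_⟩
  · rw [hdensity]
    by_cases hfz : f z = 0
    · rw [hfz, zero_mul]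
    · obtain ⟨hzx, hpos⟩ := hfU (subset_tsupport _ hfz)
      exact mul_nonneg f.nonneg ((density_pos_iff o L η hz hzx).2 hpos).le
  · rwa [hdensity, f.eq_one, one_mul]

theorem exists_formIntegral_functionSmul_ne_zero {x : S} (hx : density o L η x x ≠ 0) :
    ∃ (f : S → ℝ) (hf : ContMDiff (𝓡 3) 𝓘(ℝ) ∞ f),
      formIntegral o L (functionSmul f hf η) ≠ 0 := by
  rcases hx.lt_or_gt with hneg | hpos
  · have hpos : 0 < density o L ((-1 : ℝ) • η) x x := by
      rwa [density_of_val_eq_smul o L (c := -1) (η := η) rfl, neg_one_mul, neg_pos]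
    obtain ⟨f, hf, hint⟩ := exists_formIntegral_functionSmul_pos o L hpos
    refine ⟨f, hf, fun h₀ => hint.ne' ?_⟩
    have hcomm : functionSmul f hf ((-1 : ℝ) • η) = (-1 : ℝ) • functionSmul f hf η :=
      Form.ext (funext fun z => smul_comm (f z) (-1 : ℝ) (η.val z))
    rw [hcomm, formIntegral_smul, h₀, mul_zero]
  · obtain ⟨f, hf, hint⟩ := exists_formIntegral_functionSmul_pos o L hpos
    exact ⟨f, hf, hint.ne'⟩

end Integral

/-- The topological isomorphism `E ⧸ ker A ≃ F` induced by a continuous linear map `A` which has a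
continuous linear right inverse `R`. -/
def quotKerEquivOfRightInverse {𝕜 : Type*} [Ring 𝕜] {E F : Type*} [AddCommGroup E] [Module 𝕜 E]
    [TopologicalSpace E] [AddCommGroup F] [Module 𝕜 F] [TopologicalSpace F] (A : E →ₗ[𝕜] F)
    (hA : Continuous A) {R : F →ₗ[𝕜] E} (hR : Continuous R) (hAR : Function.RightInverse R A) :
    (E ⧸ LinearMap.ker A) ≃L[𝕜] F where
  toLinearEquiv := A.quotKerEquivOfSurjective hAR.surjective
  continuous_toFun := continuous_quot_lift _ hA
  continuous_invFun := by
    refine (continuous_quot_mk.comp hR).congr fun f => Eq.symm ?_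
    exact (A.quotKerEquivOfSurjective hAR.surjective).symm_apply_eq.2 (hAR f).symm

section SymplecticLinearAlgebra

variable {E F : Type*} [AddCommGroup E] [Module ℝ E] [TopologicalSpace E] [AddCommGroup F]
  [Module ℝ F] [TopologicalSpace F]

theorem IsSymplecticForm.comp_equiv {σ : F → F → ℝ} (hσ : IsSymplecticForm σ) (Φ : E ≃L[ℝ] F) :
    IsSymplecticForm fun p q => σ (Φ p) (Φ q) where
  bilinear := by
    obtain ⟨B, hB⟩ := hσ.bilinear
    exact ⟨B.compl₁₂ (Φ : E →ₗ[ℝ] F) (Φ : E →ₗ[ℝ] F), fun p q => hB _ _⟩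
  continuous := hσ.continuous.comp (f := fun p : E × E => (Φ p.1, Φ p.2)) (by fun_prop)
  alternating p := hσ.alternating _
  nondegenerate p hp := Φ.map_eq_zero_iff.1 <| hσ.nondegenerate _ fun q => by
    rw [← Φ.apply_symm_apply q]
    exact hp _

theorem isSymplecticForm_prod_of_separating {B : E →ₗ[ℝ] F →ₗ[ℝ] ℝ}
    (hB : Continuous fun p : E × F => B p.1 p.2) (hl : B.SeparatingLeft) (hr : B.SeparatingRight) :
    IsSymplecticForm fun p q : E × F => B p.1 q.2 - B q.1 p.2 where
  bilinear := by
    let B' := B.compl₁₂ (LinearMap.fst ℝ E F) (LinearMap.snd ℝ E F)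
    exact ⟨B' - B'.flip, fun p q => rfl⟩
  continuous :=
    (hB.comp (f := fun p : (E × F) × E × F => (p.1.1, p.2.2)) (by fun_prop)).sub
      (hB.comp (f := fun p : (E × F) × E × F => (p.2.1, p.1.2)) (by fun_prop))
  alternating p := sub_self _
  nondegenerate p hp := by
    refine Prod.ext (hl p.1 fun f => ?_) (hr p.2 fun e => ?_)
    · simpa only [map_zero, LinearMap.zero_apply, sub_zero] using hp (0, f)
    · simpa only [map_zero, zero_sub, neg_eq_zero] using hp (e, 0)

end SymplecticLinearAlgebra

section Pairing

variable {S : Type*} [TopologicalSpace S] [ChartedSpace E3 S] [IsManifold (𝓡 3) ∞ S]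
  {V : S → Type*} [TopologicalSpace (TotalSpace F4 V)] [∀ x, AddCommGroup (V x)]
  [∀ x, Module ℝ (V x)] [∀ x, TopologicalSpace (V x)] [FiberBundle F4 V] [VectorBundle ℝ F4 V]
  {i j k l : ℕ}

theorem wedge_add (α : Form V i j) (β γ : Form V k l) :
    wedge α (β + γ) = wedge α β + wedge α γ :=
  Form.ext (funext fun x => fibreWedge_add (α.val x) (β.val x) (γ.val x))

theorem wedge_smul (c : ℝ) (α : Form V i j) (β : Form V k l) :
    wedge α (c • β) = c • wedge α β :=
  Form.ext (funext fun x => fibreWedge_smul c (α.val x) (β.val x))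

theorem add_wedge (α γ : Form V i j) (β : Form V k l) :
    wedge (α + γ) β = wedge α β + wedge γ β :=
  Form.ext (funext fun x => add_fibreWedge (α.val x) (γ.val x) (β.val x))

theorem smul_wedge (c : ℝ) (α : Form V i j) (β : Form V k l) :
    wedge (c • α) β = c • wedge α β :=
  Form.ext (funext fun x => smul_fibreWedge c (α.val x) (β.val x))

theorem wedge_functionSmul {f : S → ℝ} (hf : ContMDiff (𝓡 3) 𝓘(ℝ) ∞ f) (α : Form V i j)
    (β : Form V k l) : wedge α (functionSmul f hf β) = functionSmul f hf (wedge α β) :=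
  Form.ext (funext fun x => fibreWedge_smul (f x) (α.val x) (β.val x))

theorem functionSmul_wedge {f : S → ℝ} (hf : ContMDiff (𝓡 3) 𝓘(ℝ) ∞ f) (α : Form V i j)
    (β : Form V k l) : wedge (functionSmul f hf α) β = functionSmul f hf (wedge α β) :=
  Form.ext (funext fun x => smul_fibreWedge (f x) (α.val x) (β.val x))

theorem wedge_wedge_left_comm (e b : Form V 1 1) (a : Form V 1 2) :
    (wedge b (wedge e a) : Form V 3 4) = wedge (wedge e b) a :=
  Form.ext (funext fun x => AlternatingMap.ext fun v => Subtype.ext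
    (coe_fibreWedge_fibreWedge_left_comm (e := e.val x) (b := b.val x) (a.val x) v).symm)

theorem density_ne_zero (o : ManifoldOrientation S) (L : LorentzStructure V) {η : Form V 3 4}
    {x : S} (hx : η.val x ≠ 0) : density o L η x x ≠ 0 := by
  have : FiniteDimensional ℝ (V x) := Module.finite_of_finrank_eq_succ (finrank_fibre L x)
  obtain ⟨f, -, hf⟩ := L.exists_frame x
  have hvol : L.vol x ≠ 0 := fun h => by simp [h] at hf
  have hscalar : scalarForm L x (η.val x) ≠ 0 := fun h => hx <| AlternatingMap.ext fun v =>
    alternatingMapLinearEquiv_injective (finrank_fibre L x) hvol <|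
      (congrFun (congrArg DFunLike.coe h) v).trans (map_zero _).symm
  rw [density_eq, ← coe_coordBasis (mem_chart_source E3 x)]
  exact mul_ne_zero (coordSign_ne_zero _ _ _)
    ((AlternatingMap.map_basis_ne_zero_iff _ _).2 hscalar)

theorem Form.exists_val_ne_zero {α : Form V i j} (hα : α ≠ 0) : ∃ x, α.val x ≠ 0 := by
  contrapose! hα
  exact Form.ext (funext hα)

variable [T2Space S]

theorem continuous_wedgeLeft [ContMDiffVectorBundle ∞ F4 V (𝓡 3)] (e₀ : Form V 1 1) (i j : ℕ) :
    Continuous (wedgeLeft e₀ i j) :=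
  continuous_of_fibrewise (wedgeLeft e₀ i j) (fun x => fibreWedgeₗ _ _ 1 1 i j (e₀.val x))
    fun _ _ => rfl

variable [CompactSpace S] (o : ManifoldOrientation S) (L : LorentzStructure V)

/-- The pairing `(b, Θ) ↦ ∫ b ∧ Θ` of `Ω^{1,1}_∂` with `Ω^{2,3}_∂`. -/
def integralPairing : Form V 1 1 →ₗ[ℝ] Form V 2 3 →ₗ[ℝ] ℝ :=
  LinearMap.mk₂ ℝ (fun b Θ => formIntegral o L (wedge b Θ))
    (fun b b' Θ => (congrArg _ (add_wedge b b' Θ)).trans (formIntegral_add o L _ _))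
    (fun c b Θ => (congrArg _ (smul_wedge c b Θ)).trans (formIntegral_smul o L c _))
    (fun b Θ Θ' => (congrArg _ (wedge_add b Θ Θ')).trans (formIntegral_add o L _ _))
    (fun c b Θ => (congrArg _ (wedge_smul c b Θ)).trans (formIntegral_smul o L c _))

theorem continuous_integralPairing :
    Continuous fun p : Form V 1 1 × Form V 2 3 => integralPairing o L p.1 p.2 :=
  JointlyContinuous.continuous_formIntegral o L
    ((jointlyContinuous_id.comp continuous_fst).wedge (jointlyContinuous_id.comp continuous_snd))

variable [ContMDiffVectorBundle ∞ F4 V (𝓡 3)]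

theorem integralPairing_separatingLeft : (integralPairing o L).SeparatingLeft := by
  intro b hb
  by_contra hb₀
  obtain ⟨x, hx⟩ := Form.exists_val_ne_zero hb₀
  have : FiniteDimensional ℝ (V x) := Module.finite_of_finrank_eq_succ (finrank_fibre L x)
  obtain ⟨θ, hθ⟩ := exists_fibreWedge_right_ne_zero (k := 2) (l := 3) (finrank_tangentSpace x)
    (finrank_fibre L x).ge hx
  obtain ⟨Θ, rfl⟩ := exists_form_val_eq x θ
  obtain ⟨f, hf, hint⟩ := exists_formIntegral_functionSmul_ne_zero o L
    (density_ne_zero o L (η := wedge b Θ) hθ)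
  exact hint ((congrArg _ (wedge_functionSmul hf b Θ).symm).trans (hb (functionSmul f hf Θ)))

theorem integralPairing_separatingRight : (integralPairing o L).SeparatingRight := by
  intro Θ hΘ
  by_contra hΘ₀
  obtain ⟨x, hx⟩ := Form.exists_val_ne_zero hΘ₀
  have : FiniteDimensional ℝ (V x) := Module.finite_of_finrank_eq_succ (finrank_fibre L x)
  obtain ⟨β, hβ⟩ := exists_fibreWedge_left_ne_zero (i := 1) (j := 1) (finrank_tangentSpace x)
    (finrank_fibre L x).ge hx
  obtain ⟨b, rfl⟩ := exists_form_val_eq x β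
  obtain ⟨f, hf, hint⟩ := exists_formIntegral_functionSmul_ne_zero o L
    (density_ne_zero o L (η := wedge b Θ) hβ)
  exact hint ((congrArg _ (functionSmul_wedge hf b Θ).symm).trans (hΘ (functionSmul f hf b)))

theorem isSymplecticForm_canonicalForm : IsSymplecticForm (canonicalForm (V := V) o L) :=
  isSymplecticForm_prod_of_separating (continuous_integralPairing o L)
    (integralPairing_separatingLeft o L) (integralPairing_separatingRight o L)

end Pairing

section PhaseSpaceEquiv

variable {S : Type*} [TopologicalSpace S] [ChartedSpace E3 S] [IsManifold (𝓡 3) ∞ S]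
  [T2Space S] [CompactSpace S] {V : S → Type*} [TopologicalSpace (TotalSpace F4 V)]
  [∀ x, AddCommGroup (V x)] [∀ x, Module ℝ (V x)] [∀ x, TopologicalSpace (V x)]
  [FiberBundle F4 V] [VectorBundle ℝ F4 V] [ContMDiffVectorBundle ∞ F4 V (𝓡 3)]

theorem exists_continuous_rightInverse_wedgeLeft {e₀ : Form V 1 1} (he₀ : IsBoundaryCoframe e₀)
    (hV : ∀ x, Module.finrank ℝ (V x) = 4) : ∃ R : Form V 2 3 →ₗ[ℝ] Form V 1 2, Continuous R ∧
      Function.RightInverse R (wedgeLeft e₀ 1 2) :=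
  exists_continuous_rightInverse (wedgeLeft e₀ 1 2)
    (fun x => fibreWedgeₗ _ _ 1 1 1 2 (e₀.val x)) (fun _ _ => rfl)
    fun x =>
      have : FiniteDimensional ℝ (V x) := Module.finite_of_finrank_eq_succ (hV x)
      fibreWedge_surjective (finrank_tangentSpace x) (hV x) (he₀ x)

theorem exists_phaseSpaceEquiv {e₀ : Form V 1 1} (he₀ : IsBoundaryCoframe e₀)
    (hV : ∀ x, Module.finrank ℝ (V x) = 4) : ∃ Φ : PhaseSpace e₀ ≃L[ℝ] CotangentSpace V,
      ∀ (b : Form V 1 1) (a : Form V 1 2),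
        Φ (b, Submodule.Quotient.mk a) = (b, wedge e₀ a) := by
  obtain ⟨R, hR, hAR⟩ := exists_continuous_rightInverse_wedgeLeft he₀ hV
  exact ⟨(ContinuousLinearEquiv.refl ℝ (Form V 1 1)).prodCongr
    (quotKerEquivOfRightInverse (wedgeLeft e₀ 1 2) (continuous_wedgeLeft e₀ 1 2) hR hAR),
    fun _ _ => rfl⟩

end PhaseSpaceEquiv

end LPC

end

theorem mainTheorem11
    {S : Type*} [TopologicalSpace S] [ChartedSpace LPC.E3 S] [IsManifold (𝓡 3) ∞ S]
    [T2Space S] [CompactSpace S] (o : LPC.ManifoldOrientation S)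
    (V : S → Type*) [TopologicalSpace (TotalSpace LPC.F4 V)] [∀ x, AddCommGroup (V x)]
    [∀ x, Module ℝ (V x)] [∀ x, TopologicalSpace (V x)] [FiberBundle LPC.F4 V]
    [VectorBundle ℝ LPC.F4 V] [ContMDiffVectorBundle ∞ LPC.F4 V (𝓡 3)]
    (L : LPC.LorentzStructure V) (e₀ : LPC.Form V 1 1) (he₀ : LPC.IsBoundaryCoframe e₀) :
    LPC.IsSymplecticForm (LPC.canonicalForm o L) ∧
    ∃ ϖ : LPC.PhaseSpace e₀ → LPC.PhaseSpace e₀ → ℝ,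
      (∀ (b b' : LPC.Form V 1 1) (a a' : LPC.Form V 1 2),
        ϖ (b, Submodule.Quotient.mk a) (b', Submodule.Quotient.mk a') =
          LPC.preForm o L e₀ (b, a) (b', a')) ∧
      LPC.IsSymplecticForm ϖ ∧
      ∃ Φ : LPC.PhaseSpace e₀ ≃L[ℝ] LPC.CotangentSpace V,
        (∀ (b : LPC.Form V 1 1) (a : LPC.Form V 1 2),
          Φ (b, Submodule.Quotient.mk a) = (b, LPC.wedge e₀ a)) ∧
        ∀ p q : LPC.PhaseSpace e₀, LPC.canonicalForm o L (Φ p) (Φ q) = ϖ p q := by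
  have hσ := LPC.isSymplecticForm_canonicalForm o L
  obtain ⟨Φ, hΦ⟩ := LPC.exists_phaseSpaceEquiv he₀ (LPC.finrank_fibre L)
  refine ⟨hσ, fun p q => LPC.canonicalForm o L (Φ p) (Φ q), fun b b' a a' => ?_,
    hσ.comp_equiv Φ, Φ, hΦ, fun _ _ => rfl⟩
  have hintegral (b : LPC.Form V 1 1) (a : LPC.Form V 1 2) :
      LPC.formIntegral o L (LPC.wedge b (LPC.wedge e₀ a)) =
        LPC.formIntegral o L (LPC.wedge (LPC.wedge e₀ b) a) :=
    congrArg _ (LPC.wedge_wedge_left_comm e₀ b a)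
  simp only [hΦ]
  exact congrArg₂ (· - ·) (hintegral b a') (hintegral b' a)
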